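/- Let $k$ be a field and $q\in k^\times$. Let $H_q$ be the Hopf algebra over $k$ generated by $\sigma^{\pm1},D_1,D_2$ with relations $\sigma\sigma^{-1}=\sigma^{-1}\sigma=1$, $D_1D_2=D_2D_1$, $q\sigma D_i=D_i\sigma$ and, if $q$ is a primitive $l$-th root of unity with $l\ge 2$, also $D_1^l=D_2^l=0$; its coalgebra structure is given by $\Delta(\sigma)=\sigma\otimes\sigma$, $\Delta(D_1)=D_1\otimes\sigma+1\otimes D_1$, $\Delta(D_2)=D_2\otimes 1+\sigma\otimes D_2$, $\epsilon(\sigma)=1$, $\epsilon(D_i)=0$. For a $k$-algebra $A$, a (left) transposition of $H_q$ on $A$ is a bijective $k$-linear map $s\colon H_q\otimes A\to A\otimes H_q$ that is compatible with the unit, multiplication, counit and comultiplication of $H_q$, with the flip of $H_q\otimes H_q$, and with the unit and multiplication of $A$. It is good if $(s\otimes H_q)(H_q\otimes s)(D_1\otimes D_2\otimes a)=a\otimes D_1\otimes D_2$ for all $a\in A$. For each algebra automorphism $\alpha$ of $A$ there is exactly one good transposition $s$ with $s(D_1\otimes a)=\alpha(a)\otimes D_1$ for all $a$; it is called the good transposition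 associated with $\alpha$. An $H_q$-module algebra structure on $(A,s)$ is a left $H_q$-module structure $\rho\colon H_q\otimes A\to A$, $h\cdot a=\rho(h\otimes a)$, such that $s\circ(H_q\otimes\rho)=(\rho\otimes H_q)\circ(H_q\otimes s)\circ(\tau\otimes A)$ ($\tau$ the flip), $h\cdot(ab)=\mu_A(\rho\otimes\rho)(H_q\otimes s\otimes A)(\Delta(h)\otimes a\otimes b)$ and $h\cdot 1=\epsilon(h)1$. Let $G$ be a group acting linearly on a finite-dimensional $k$-vector space $V$, let $f\colon G\times G\to k^\times$ be a normal $2$-cocycle (trivial action on $k^\times$), and let $A=S(V)\#_fG$ be the crossed product, i.e. the free left $S(V)$-module with basis $\{w_g\}_{g\in G}$ and product $(Pw_g)(Qw_h)=P\,{}^gQ\,f(g,h)\,w_{gh}$. Let $\hat\alpha\colon V\to V$ be a bijective $k[G]$-linear map, $\chi_\alpha\colon G\to k^\times$ a group homomorphism, $\alpha$ the automorphism of $A$ with $\alpha(v)=\hat\alpha(v)$ and $\alpha(w_g)=\chi_\alpha(g)w_g$, and $s$ the good transposition associated with $\alpha$. Moreover let: a) $V_1\ne V_2$ be $\hat\alpha$-stable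 $G$-submodules of $V$ of codimension $1$; b) $g_1,g_2$ be central elements of $G$ such that ${}^{g_1^{-1}}v={}^{g_2}v$ for all $v\in V_1\cap V_2$; c) $\chi_\varsigma\colon G\to k^\times$ be a group homomorphism and $\hat\varsigma\colon V\to V$ the linear map with $\hat\varsigma(v)=\hat\alpha({}^{g_1^{-1}}v)$ for $v\in V_1$ and $\hat\varsigma(v)=\hat\alpha({}^{g_2}v)$ for $v\in V_2$; d) $x_1\in V_2\setminus V_1$, $x_2\in V_1\setminus V_2$, $0\ne P_1\in S(V_1)$, $0\ne P_2\in S(V_2)$, and $\hat\delta_i\colon V\to A$ the linear map with $\ker\hat\delta_i=V_i$ and $\hat\delta_i(x_i)=P_iw_{g_i}$ ($i=1,2$). Let $\lambda_{ig},\nu_i\in k$ be defined by ${}^gx_i-\lambda_{ig}x_i\in V_i$ and $\hat\alpha(x_i)-\nu_ix_i\in V_i$. Let $\varsigma\colon A\to A$ be the linear map $\varsigma(v_1\cdots v_mw_g)=\hat\varsigma(v_1)\cdots\hat\varsigma(v_m)\chi_\varsigma(g)w_g$, and let $\delta_1,\delta_2\colon A\to A$ be the (well-defined) linear maps $$\delta_1(v_1\cdots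 v_mw_g)=\sum_{j=1}^m\alpha(v_1\cdots v_{j-1})\,\hat\delta_1(v_j)\,\varsigma(v_{j+1}\cdots v_mw_g),$$ $$\delta_2(v_1\cdots v_mw_g)=\sum_{j=1}^m\varsigma\bigl(\alpha^{-1}(v_1\cdots v_{j-1})\bigr)\,\hat\delta_2(v_j)\,v_{j+1}\cdots v_mw_g .$$ Then there is an $H_q$-module algebra structure on $(A,s)$ such that $\sigma\cdot v=\hat\varsigma(v)$, $\sigma\cdot w_g=\chi_\varsigma(g)w_g$, $D_i\cdot v=\hat\delta_i(v)$ and $D_i\cdot w_g=0$ for all $v\in V$, $g\in G$ and $i\in\{1,2\}$, if and only if 1. $q=\lambda_{1g_1}\lambda_{1g_2}$ and $q^{-1}=\lambda_{2g_1}\lambda_{2g_2}$; 2. ${}^gP_1=\lambda_{1g}\,\chi_\alpha^{-1}(g)\,\chi_\varsigma(g)\,f^{-1}(g,g_1)\,f(g_1,g)\,P_1$ for all $g\in G$; 3. ${}^gP_2=\lambda_{2g}\,\chi_\alpha(g)\,\chi_\varsigma^{-1}(g)\,f^{-1}(g,g_2)\,f(g_2,g)\,P_2$ for all $g\in G$;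 4. $\alpha(P_i)=\nu_i\,\chi_\alpha^{-1}(g_i)\,P_i$ for $i\in\{1,2\}$; 5. $P_1\in\ker\delta_2$ and $P_2\in\ker\delta_1$; 6. if $q$ is a primitive $l$-th root of unity with $l\ge2$, then $\delta_1^l=\delta_2^l=0$. -/

import Mathlib

open scoped TensorProduct

noncomputable section

/-! ### The Hopf algebra `H_q` -/

/-- Names of the algebra generators of `H_q`. -/
inductive HqGen
  | sigma | sigmaInv | D1 | D2

/-- The defining relations of `H_q`; the last two only occur when `q` is a primitive
`l`-th root of unity with `l ≥ 2`. -/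
inductive HqRel {k : Type*} [Field k] (q : kˣ) :
    FreeAlgebra k HqGen → FreeAlgebra k HqGen → Prop
  | comm : HqRel q (FreeAlgebra.ι k HqGen.D1 * FreeAlgebra.ι k HqGen.D2)
      (FreeAlgebra.ι k HqGen.D2 * FreeAlgebra.ι k HqGen.D1)
  | sigma_mul_inv : HqRel q (FreeAlgebra.ι k HqGen.sigma * FreeAlgebra.ι k HqGen.sigmaInv) 1
  | inv_mul_sigma : HqRel q (FreeAlgebra.ι k HqGen.sigmaInv * FreeAlgebra.ι k HqGen.sigma) 1
  | sigma_D1 : HqRel q ((q : k) • (FreeAlgebra.ι k HqGen.sigma * FreeAlgebra.ι k HqGen.D1))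
      (FreeAlgebra.ι k HqGen.D1 * FreeAlgebra.ι k HqGen.sigma)
  | sigma_D2 : HqRel q ((q : k) • (FreeAlgebra.ι k HqGen.sigma * FreeAlgebra.ι k HqGen.D2))
      (FreeAlgebra.ι k HqGen.D2 * FreeAlgebra.ι k HqGen.sigma)
  | D1_pow (l : ℕ) (hl : 2 ≤ l) (hq : IsPrimitiveRoot (q : k) l) :
      HqRel q (FreeAlgebra.ι k HqGen.D1 ^ l) 0
  | D2_pow (l : ℕ) (hl : 2 ≤ l) (hq : IsPrimitiveRoot (q : k) l) :
      HqRel q (FreeAlgebra.ι k HqGen.D2 ^ l) 0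

/-- The algebra `H_q`, generated by `σ`, `σ⁻¹`, `D₁`, `D₂` with relations `D₁ D₂ = D₂ D₁`,
`σ σ⁻¹ = σ⁻¹ σ = 1`, `q σ Dᵢ = Dᵢ σ` and, if `q` is a primitive `l`-th root of unity with `l ≥ 2`,
`Dᵢ ^ l = 0`. -/
def Hq {k : Type*} [Field k] (q : kˣ) : Type _ := RingQuot (HqRel q)

namespace Hq

variable {k : Type*} [Field k] (q : kˣ)

instance : Ring (Hq q) := inferInstanceAs (Ring (RingQuot (HqRel q)))

instance : Algebra k (Hq q) := inferInstanceAs (Algebra k (RingQuot (HqRel q)))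

/-- The class in `H_q` of a generator. -/
def gen (x : HqGen) : Hq q := RingQuot.mkAlgHom k (HqRel q) (FreeAlgebra.ι k x)

/-- The generator `σ`. -/
def σ : Hq q := gen q HqGen.sigma

/-- The generator `σ⁻¹`. -/
def σinv : Hq q := gen q HqGen.sigmaInv

/-- The generator `D₁`. -/
def D₁ : Hq q := gen q HqGen.D1

/-- The generator `D₂`. -/
def D₂ : Hq q := gen q HqGen.D2

theorem D₁_mul_D₂ : D₁ q * D₂ q = D₂ q * D₁ q := by
  have := RingQuot.mkAlgHom_rel k (HqRel.comm (q := q))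
  simp only [map_mul] at this
  exact this

theorem σ_mul_σinv : σ q * σinv q = 1 := by
  have := RingQuot.mkAlgHom_rel k (HqRel.sigma_mul_inv (q := q))
  simp only [map_mul, map_one] at this
  exact this

theorem σinv_mul_σ : σinv q * σ q = 1 := by
  have := RingQuot.mkAlgHom_rel k (HqRel.inv_mul_sigma (q := q))
  simp only [map_mul, map_one] at this
  exact this

theorem D₁_mul_σ : D₁ q * σ q = (q : k) • (σ q * D₁ q) := by
  have := RingQuot.mkAlgHom_rel k (HqRel.sigma_D1 (q := q))
  simp only [map_mul, map_smul] at this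
  exact this.symm

theorem D₂_mul_σ : D₂ q * σ q = (q : k) • (σ q * D₂ q) := by
  have := RingQuot.mkAlgHom_rel k (HqRel.sigma_D2 (q := q))
  simp only [map_mul, map_smul] at this
  exact this.symm

theorem D₁_pow (l : ℕ) (hl : 2 ≤ l) (hq : IsPrimitiveRoot (q : k) l) : D₁ q ^ l = 0 := by
  have := RingQuot.mkAlgHom_rel k (HqRel.D1_pow (q := q) l hl hq)
  simp only [map_pow, map_zero] at this
  exact this

theorem D₂_pow (l : ℕ) (hl : 2 ≤ l) (hq : IsPrimitiveRoot (q : k) l) : D₂ q ^ l = 0 := by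
  have := RingQuot.mkAlgHom_rel k (HqRel.D2_pow (q := q) l hl hq)
  simp only [map_pow, map_zero] at this
  exact this

section lift

variable {B : Type*} [Ring B] [Algebra k B]

/-- The universal property of `H_q`. -/
def lift (s t d e : B) (hde : d * e = e * d) (hst : s * t = 1) (hts : t * s = 1)
    (hd : d * s = (q : k) • (s * d)) (he : e * s = (q : k) • (s * e))
    (hdl : ∀ l : ℕ, 2 ≤ l → IsPrimitiveRoot (q : k) l → d ^ l = 0)
    (hel : ∀ l : ℕ, 2 ≤ l → IsPrimitiveRoot (q : k) l → e ^ l = 0) : Hq q →ₐ[k] B :=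
  RingQuot.liftAlgHom k ⟨FreeAlgebra.lift k (fun x : HqGen => match x with
    | .sigma => s | .sigmaInv => t | .D1 => d | .D2 => e), by
      intro x y h
      cases h with
      | comm => simpa using hde
      | sigma_mul_inv => simpa using hst
      | inv_mul_sigma => simpa using hts
      | sigma_D1 => simpa using hd.symm
      | sigma_D2 => simpa using he.symm
      | D1_pow l hl hq => simpa using hdl l hl hq
      | D2_pow l hl hq => simpa using hel l hl hq⟩

variable (s t d e : B) (hde : d * e = e * d) (hst : s * t = 1) (hts : t * s = 1)
    (hd : d * s = (q : k) • (s * d)) (he : e * s = (q : k) • (s * e))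
    (hdl : ∀ l : ℕ, 2 ≤ l → IsPrimitiveRoot (q : k) l → d ^ l = 0)
    (hel : ∀ l : ℕ, 2 ≤ l → IsPrimitiveRoot (q : k) l → e ^ l = 0)

@[simp] theorem lift_σ : lift q s t d e hde hst hts hd he hdl hel (σ q) = s :=
  (RingQuot.liftAlgHom_mkAlgHom_apply _ _ _ _).trans (by simp)

@[simp] theorem lift_σinv : lift q s t d e hde hst hts hd he hdl hel (σinv q) = t :=
  (RingQuot.liftAlgHom_mkAlgHom_apply _ _ _ _).trans (by simp)

@[simp] theorem lift_D₁ : lift q s t d e hde hst hts hd he hdl hel (D₁ q) = d :=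
  (RingQuot.liftAlgHom_mkAlgHom_apply _ _ _ _).trans (by simp)

@[simp] theorem lift_D₂ : lift q s t d e hde hst hts hd he hdl hel (D₂ q) = e :=
  (RingQuot.liftAlgHom_mkAlgHom_apply _ _ _ _).trans (by simp)

variable {q} in
theorem algHom_ext {F F' : Hq q →ₐ[k] B} (h1 : F (σ q) = F' (σ q))
    (h2 : F (σinv q) = F' (σinv q)) (h3 : F (D₁ q) = F' (D₁ q)) (h4 : F (D₂ q) = F' (D₂ q)) :
    F = F' := by
  apply RingQuot.ringQuot_ext'
  ext x
  cases x
  · exact h1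
  · exact h2
  · exact h3
  · exact h4

end lift

/-- Gaussian binomial coefficients. -/
def qChoose (z : k) : ℕ → ℕ → k
  | _, 0 => 1
  | 0, _ + 1 => 0
  | n + 1, i + 1 => qChoose z n (i + 1) + z ^ (n - i) * qChoose z n i

/-- The `q`-integer `1 + z + ⋯ + z ^ (n - 1)`. -/
def qInt (z : k) (n : ℕ) : k := ∑ i ∈ Finset.range n, z ^ i

theorem qChoose_eq_zero (z : k) : ∀ n i : ℕ, n < i → qChoose z n i = 0
  | 0, i + 1, _ => by simp [qChoose]
  | n + 1, i + 1, h => by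
    rw [qChoose, qChoose_eq_zero z n (i + 1) (by omega), qChoose_eq_zero z n i (by omega)]
    simp

theorem qChoose_self (z : k) : ∀ n : ℕ, qChoose z n n = 1
  | 0 => by simp [qChoose]
  | n + 1 => by
    rw [qChoose, qChoose_eq_zero z n (n + 1) (by omega), qChoose_self z n]
    simp

theorem qInt_add (z : k) (a b : ℕ) : qInt z (a + b) = qInt z a + z ^ a * qInt z b := by
  simp [qInt, Finset.sum_range_add, Finset.mul_sum, pow_add]

theorem qInt_mul_qChoose (z : k) : ∀ n i : ℕ,
    qInt z (i + 1) * qChoose z (n + 1) (i + 1) = qInt z (n + 1) * qChoose z n i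
  | 0, 0 => by simp [qChoose, qInt]
  | 0, i + 1 => by simp [qChoose, qInt]
  | n + 1, 0 => by
    have := qInt_mul_qChoose z n 0
    have h1 : qInt z 1 = 1 := by simp [qInt]
    simp only [zero_add, h1, one_mul] at this ⊢
    have hq1 : qChoose z (n + 2) 1 = qChoose z (n + 1) 1 + z ^ (n + 1) * qChoose z (n + 1) 0 := by
      conv_lhs => rw [qChoose]
      rfl
    change qChoose z (n + 2) 1 = qInt z (n + 1 + 1) * _
    rw [hq1, this, qInt_add z (n + 1) 1, h1]
    simp [qChoose]
  | n + 1, i + 1 => by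
    have e1 := qInt_mul_qChoose z n (i + 1)
    have e2 := qInt_mul_qChoose z n i
    by_cases h : i ≤ n
    · have e3 : qInt z (n + 2) = qInt z (i + 2) + z ^ (i + 2) * qInt z (n - i) := by
        rw [← qInt_add]; congr 1; omega
      have e4 : qInt z (n + 1) = qInt z (n - i) + z ^ (n - i) * qInt z (i + 1) := by
        rw [← qInt_add]; congr 1; omega
      have e5 : qInt z (n + 2) = qInt z (n - i) + z ^ (n - i) * qInt z (i + 2) := by
        rw [← qInt_add]; congr 1; omega
      have e6 : n + 1 - (i + 1) = n - i := by omega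
      have hq1 : qChoose z (n + 2) (i + 2)
        = qChoose z (n + 1) (i + 2) + z ^ (n - i) * qChoose z (n + 1) (i + 1) := by
        conv_lhs => rw [qChoose]
        rw [e6]
      have hq2 : qChoose z (n + 1) (i + 1)
        = qChoose z n (i + 1) + z ^ (n - i) * qChoose z n i := by
        conv_lhs => rw [qChoose]
      change qInt z (i + 2) * qChoose z (n + 2) (i + 2) = _
      change qInt z (i + 2) * qChoose z (n + 1) (i + 2) = _ at e1
      rw [hq1, mul_add, e1]
      change _ = qInt z (n + 2) * _
      rw [e5]
      have e7 : qInt z (n + 1) * qChoose z n (i + 1) =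
        qInt z (n + 1) * qChoose z (n + 1) (i + 1) - z ^ (n - i) * (qInt z (n + 1) * qChoose z n i) := by
        rw [hq2]; ring
      rw [e7, ← e2, e4]
      ring
    · rw [qChoose_eq_zero z (n + 2) (i + 2) (by omega), qChoose_eq_zero z (n + 1) (i + 1) (by omega)]
      simp

theorem qInt_root {z : k} {l : ℕ} (hl : 2 ≤ l) (hz : IsPrimitiveRoot z l) : qInt z l = 0 :=
  hz.geom_sum_eq_zero (by omega)

theorem qInt_ne_zero {z : k} {l : ℕ} (hz : IsPrimitiveRoot z l) {i : ℕ} (h0 : 0 < i)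
    (h1 : i < l) : qInt z i ≠ 0 := by
  intro h
  have h2 : z ^ i = 1 := by
    have := mul_geom_sum z i
    rw [qInt] at h
    rw [h, mul_zero] at this
    exact (sub_eq_zero.1 this.symm)
  exact hz.pow_ne_one_of_pos_of_lt (by omega) h1 h2

theorem qChoose_root {z : k} {l : ℕ} (hl : 2 ≤ l) (hz : IsPrimitiveRoot z l) {i : ℕ} (h0 : 0 < i)
    (h1 : i < l) : qChoose z l i = 0 := by
  obtain ⟨j, rfl⟩ : ∃ j, i = j + 1 := ⟨i - 1, by omega⟩
  obtain ⟨m, rfl⟩ : ∃ m, l = m + 1 := ⟨l - 1, by omega⟩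
  have := qInt_mul_qChoose z m j
  rw [qInt_root hl hz, zero_mul] at this
  exact (mul_eq_zero.1 this).resolve_left (qInt_ne_zero hz h0 h1)

/-- The `q`-binomial theorem. -/
theorem add_pow_q {B : Type*} [Ring B] [Algebra k B] (z : k) (x y : B)
    (h : y * x = z • (x * y)) (n : ℕ) :
    (x + y) ^ n = ∑ i ∈ Finset.range (n + 1), qChoose z n i • (x ^ i * y ^ (n - i)) := by
  have hy : ∀ m : ℕ, y ^ m * x = z ^ m • (x * y ^ m) := by
    intro m
    induction m with
    | zero => simp
    | succ m ih =>
      rw [pow_succ, mul_assoc, h, mul_smul_comm, ← mul_assoc, ih, smul_mul_assoc, smul_smul,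
        mul_assoc, pow_succ, mul_comm z]
  induction n with
  | zero => simp [qChoose]
  | succ n ih =>
    have key : ∀ i ∈ Finset.range (n + 1),
        (qChoose z n i • (x ^ i * y ^ (n - i))) * (x + y)
        = (z ^ (n - i) * qChoose z n i) • (x ^ (i + 1) * y ^ (n - i))
          + qChoose z n i • (x ^ i * y ^ (n + 1 - i)) := by
      intro i hi
      have : n + 1 - i = n - i + 1 := by
        have := Finset.mem_range.1 hi; omega
      rw [mul_add, smul_mul_assoc, smul_mul_assoc, mul_assoc, hy, mul_smul_comm, smul_smul,
        ← mul_assoc, ← pow_succ, mul_assoc, ← pow_succ, this, mul_comm]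
    rw [pow_succ, ih, Finset.sum_mul, Finset.sum_congr rfl key, Finset.sum_add_distrib,
      Finset.sum_range_succ' _ (n + 1)]
    have h2 : ∀ i ∈ Finset.range (n + 1),
        qChoose z (n + 1) (i + 1) • (x ^ (i + 1) * y ^ (n + 1 - (i + 1)))
        = (z ^ (n - i) * qChoose z n i) • (x ^ (i + 1) * y ^ (n - i))
          + qChoose z n (i + 1) • (x ^ (i + 1) * y ^ (n - i)) := by
      intro i _
      rw [qChoose, add_smul, add_comm, Nat.add_sub_add_right]
    rw [Finset.sum_congr rfl h2, Finset.sum_add_distrib, add_assoc]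
    congr 1
    rw [Finset.sum_range_succ (fun i => qChoose z n (i + 1) • (x ^ (i + 1) * y ^ (n - i))),
      qChoose_eq_zero z n (n + 1) (by omega), zero_smul, add_zero,
      Finset.sum_range_succ' _ n]
    congr 1
    · refine Finset.sum_congr rfl fun i _ => ?_
      rw [Nat.add_sub_add_right]
    · simp [qChoose]

theorem add_pow_root {B : Type*} [Ring B] [Algebra k B] {z : k} {l : ℕ} (hl : 2 ≤ l)
    (hz : IsPrimitiveRoot z l) (x y : B) (h : y * x = z • (x * y)) (hx : x ^ l = 0)
    (hy : y ^ l = 0) : (x + y) ^ l = 0 := by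
  rw [add_pow_q z x y h]
  refine Finset.sum_eq_zero fun i hi => ?_
  rcases Nat.eq_zero_or_pos i with rfl | h0
  · simp [hy]
  · rcases (Nat.lt_succ_iff.1 (Finset.mem_range.1 hi)).lt_or_eq with h1 | rfl
    · rw [qChoose_root hl hz h0 h1, zero_smul]
    · simp [hx]

/-- The comultiplication: `Δ(σ) = σ ⊗ σ`, `Δ(D₁) = D₁ ⊗ σ + 1 ⊗ D₁`, `Δ(D₂) = D₂ ⊗ 1 + σ ⊗ D₂`. -/
def comulHom : Hq q →ₐ[k] Hq q ⊗[k] Hq q :=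
  lift q (σ q ⊗ₜ σ q) (σinv q ⊗ₜ σinv q) (D₁ q ⊗ₜ σ q + 1 ⊗ₜ D₁ q) (D₂ q ⊗ₜ 1 + σ q ⊗ₜ D₂ q)
    (by
      simp only [mul_add, add_mul, Algebra.TensorProduct.tmul_mul_tmul, one_mul, mul_one,
        D₁_mul_D₂, D₁_mul_σ, D₂_mul_σ, TensorProduct.smul_tmul', TensorProduct.tmul_smul]
      abel)
    (by simp [Algebra.TensorProduct.tmul_mul_tmul, σ_mul_σinv, Algebra.TensorProduct.one_def])
    (by simp [Algebra.TensorProduct.tmul_mul_tmul, σinv_mul_σ, Algebra.TensorProduct.one_def])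
    (by
      simp only [mul_add, add_mul, Algebra.TensorProduct.tmul_mul_tmul, one_mul, mul_one,
        D₁_mul_σ, TensorProduct.smul_tmul', TensorProduct.tmul_smul, smul_add])
    (by
      simp only [mul_add, add_mul, Algebra.TensorProduct.tmul_mul_tmul, one_mul, mul_one,
        D₂_mul_σ, TensorProduct.smul_tmul', TensorProduct.tmul_smul, smul_add])
    (fun l hl hq => add_pow_root hl hq _ _
      (by simp [Algebra.TensorProduct.tmul_mul_tmul, D₁_mul_σ, TensorProduct.tmul_smul])
      (by simp [Algebra.TensorProduct.tmul_pow, D₁_pow q l hl hq])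
      (by simp [Algebra.TensorProduct.tmul_pow, D₁_pow q l hl hq]))
    (fun l hl hq => by
      rw [add_comm]
      exact add_pow_root hl hq _ _
        (by simp [Algebra.TensorProduct.tmul_mul_tmul, D₂_mul_σ, TensorProduct.smul_tmul'])
        (by simp [Algebra.TensorProduct.tmul_pow, D₂_pow q l hl hq])
        (by simp [Algebra.TensorProduct.tmul_pow, D₂_pow q l hl hq]))

/-- The counit: `ε(σ) = 1`, `ε(D₁) = ε(D₂) = 0`. -/
def counitHom : Hq q →ₐ[k] k :=
  lift q 1 1 0 0 (by simp) (by simp) (by simp) (by simp) (by simp)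
    (fun l hl _ => zero_pow (by omega)) (fun l hl _ => zero_pow (by omega))

/-- The bialgebra structure of `H_q`. -/
instance : Bialgebra k (Hq q) :=
  Bialgebra.ofAlgHom (comulHom q) (counitHom q)
    (by
      apply algHom_ext <;>
      simp [comulHom, TensorProduct.add_tmul, TensorProduct.tmul_add, add_assoc,
        Algebra.TensorProduct.one_def])
    (by apply algHom_ext <;> simp [comulHom, counitHom])
    (by apply algHom_ext <;> simp [comulHom, counitHom])

end Hq

/-! ### Transpositions and braided module algebras -/

namespace Braided

section general

variable {k H A : Type*} [Field k] [Ring H] [Bialgebra k H] [Ring A] [Algebra k A]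

/-- The map `(s ⊗ H) ∘ (H ⊗ s) : H ⊗ H ⊗ A → A ⊗ H ⊗ H`. -/
def twice (s : H ⊗[k] A →ₗ[k] A ⊗[k] H) : H ⊗[k] (H ⊗[k] A) →ₗ[k] A ⊗[k] (H ⊗[k] H) :=
  (TensorProduct.assoc k A H H).toLinearMap ∘ₗ LinearMap.rTensor H s ∘ₗ
    (TensorProduct.assoc k H A H).symm.toLinearMap ∘ₗ LinearMap.lTensor H s

/-- The map `(A ⊗ s) ∘ (s ⊗ A) : H ⊗ A ⊗ A → A ⊗ A ⊗ H`. -/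
def twice' (s : H ⊗[k] A →ₗ[k] A ⊗[k] H) : H ⊗[k] (A ⊗[k] A) →ₗ[k] (A ⊗[k] A) ⊗[k] H :=
  (TensorProduct.assoc k A A H).symm.toLinearMap ∘ₗ LinearMap.lTensor A s ∘ₗ
    (TensorProduct.assoc k A H A).toLinearMap ∘ₗ LinearMap.rTensor A s ∘ₗ
      (TensorProduct.assoc k H A A).symm.toLinearMap

/-- The map `H ⊗ s ⊗ A : H ⊗ H ⊗ A ⊗ A → H ⊗ A ⊗ H ⊗ A`. -/
def middle (s : H ⊗[k] A →ₗ[k] A ⊗[k] H) :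
    (H ⊗[k] H) ⊗[k] (A ⊗[k] A) →ₗ[k] (H ⊗[k] A) ⊗[k] (H ⊗[k] A) :=
  (TensorProduct.assoc k H A (H ⊗[k] A)).symm.toLinearMap ∘ₗ
    LinearMap.lTensor H ((TensorProduct.assoc k A H A).toLinearMap ∘ₗ LinearMap.rTensor A s ∘ₗ
      (TensorProduct.assoc k H A A).symm.toLinearMap) ∘ₗ
    (TensorProduct.assoc k H H (A ⊗[k] A)).toLinearMap

/-- `s : H ⊗ A → A ⊗ H` is a left transposition of `H` on the algebra `A`, where the bialgebra
`H` is braided by the flip. -/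
structure IsTransposition (s : H ⊗[k] A →ₗ[k] A ⊗[k] H) : Prop where
  bijective : Function.Bijective s
  one_left : ∀ a : A, s (1 ⊗ₜ a) = a ⊗ₜ 1
  mul_left : ∀ (h h' : H) (a : A),
    s ((h * h') ⊗ₜ a) = LinearMap.lTensor A (LinearMap.mul' k H) (twice s (h ⊗ₜ (h' ⊗ₜ a)))
  counit : ∀ (h : H) (a : A),
    LinearMap.lTensor A (Coalgebra.counit (R := k) (A := H)) (s (h ⊗ₜ a)) =
      a ⊗ₜ Coalgebra.counit (R := k) h
  comul : ∀ (h : H) (a : A),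
    LinearMap.lTensor A (Coalgebra.comul (R := k) (A := H)) (s (h ⊗ₜ a)) =
      twice s (TensorProduct.assoc k H H A (Coalgebra.comul (R := k) h ⊗ₜ a))
  braid : ∀ (h h' : H) (a : A),
    twice s (h' ⊗ₜ (h ⊗ₜ a)) =
      LinearMap.lTensor A (TensorProduct.comm k H H).toLinearMap (twice s (h ⊗ₜ (h' ⊗ₜ a)))
  one_right : ∀ h : H, s (h ⊗ₜ 1) = 1 ⊗ₜ h
  mul_right : ∀ (h : H) (a b : A),
    s (h ⊗ₜ (a * b)) = LinearMap.rTensor H (LinearMap.mul' k A) (twice' s (h ⊗ₜ (a ⊗ₜ b)))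

/-- The action `act : H ⊗ A → A` makes `(A, s)` a left `H`-module algebra (in the braided sense,
with `H` braided by the flip). -/
structure IsModuleAlgebra (s : H ⊗[k] A →ₗ[k] A ⊗[k] H) (act : H ⊗[k] A →ₗ[k] A) : Prop where
  transposition : IsTransposition s
  one_act : ∀ a : A, act (1 ⊗ₜ a) = a
  mul_act : ∀ (h h' : H) (a : A), act ((h * h') ⊗ₜ a) = act (h ⊗ₜ act (h' ⊗ₜ a))
  braid : ∀ (h h' : H) (a : A),
    s (h ⊗ₜ act (h' ⊗ₜ a)) =
      LinearMap.rTensor H act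
        ((TensorProduct.assoc k H A H).symm (LinearMap.lTensor H s (h' ⊗ₜ (h ⊗ₜ a))))
  act_mul : ∀ (h : H) (a b : A),
    act (h ⊗ₜ (a * b)) =
      LinearMap.mul' k A (TensorProduct.map act act
        (middle s (Coalgebra.comul (R := k) h ⊗ₜ (a ⊗ₜ b))))
  act_one : ∀ h : H, act (h ⊗ₜ 1) = Coalgebra.counit (R := k) h • (1 : A)

end general

section Hq

variable {k A : Type*} [Field k] [Ring A] [Algebra k A] (q : kˣ)

/-- `s` is good: `(s ⊗ H_q) ∘ (H_q ⊗ s)` maps `D₁ ⊗ D₂ ⊗ a` to `a ⊗ D₁ ⊗ D₂`. -/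
def IsGood (s : Hq q ⊗[k] A →ₗ[k] A ⊗[k] Hq q) : Prop :=
  ∀ a : A, twice s (Hq.D₁ q ⊗ₜ (Hq.D₂ q ⊗ₜ a)) = a ⊗ₜ (Hq.D₁ q ⊗ₜ Hq.D₂ q)

/-- Homogeneous elements of `H_q`, for the grading with `σ` in degree `0`, `D₁` in degree `1`,
`D₂` in degree `-1` (an auxiliary notion for the existence of good transpositions). -/
inductive Homog : ℤ → Hq q → Prop
  | one : Homog 0 1
  | sigma : Homog 0 (Hq.σ q)
  | sigmaInv : Homog 0 (Hq.σinv q)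
  | D1 : Homog 1 (Hq.D₁ q)
  | D2 : Homog (-1) (Hq.D₂ q)
  | mul {m n : ℤ} {h h' : Hq q} : Homog m h → Homog n h' → Homog (m + n) (h * h')

theorem span_homog : Submodule.span k {h : Hq q | ∃ n, Homog q n h} = ⊤ := by
  rw [eq_top_iff]
  intro x _
  obtain ⟨y, rfl⟩ := RingQuot.mkAlgHom_surjective k (HqRel q) x
  induction y using FreeAlgebra.induction with
  | grade0 r =>
    rw [AlgHom.commutes, Algebra.algebraMap_eq_smul_one]
    exact Submodule.smul_mem _ _ (Submodule.subset_span ⟨0, Homog.one⟩)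
  | grade1 x =>
    refine Submodule.subset_span ?_
    cases x
    · exact ⟨_, Homog.sigma⟩
    · exact ⟨_, Homog.sigmaInv⟩
    · exact ⟨_, Homog.D1⟩
    · exact ⟨_, Homog.D2⟩
  | add a b ha hb =>
    rw [map_add]
    exact Submodule.add_mem _ (ha trivial) (hb trivial)
  | mul a b ha hb =>
    rw [map_mul]
    have h := Submodule.mul_mem_mul (ha trivial) (hb trivial)
    rw [Submodule.span_mul_span] at h
    refine Submodule.span_mono ?_ h
    rintro _ ⟨u, ⟨m, hu⟩, v, ⟨n, hv⟩, rfl⟩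
    exact ⟨_, Homog.mul hu hv⟩

theorem homog_ext {M : Type*} [AddCommGroup M] [Module k M] {f g : Hq q →ₗ[k] M}
    (h : ∀ n x, Homog q n x → f x = g x) : f = g :=
  LinearMap.ext_on (span_homog q) (by rintro x ⟨n, hx⟩; exact h n x hx)

theorem homog_ind {f : Hq q → Prop} (hz : f 0) (ha : ∀ x y, f x → f y → f (x + y))
    (hs : ∀ (c : k) x, f x → f (c • x)) (h : ∀ n x, Homog q n x → f x) (x : Hq q) : f x := by
  have hx : x ∈ Submodule.span k {h : Hq q | ∃ n, Homog q n h} := by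
    rw [span_homog]; trivial
  induction hx using Submodule.span_induction with
  | mem x hx => obtain ⟨n, hx⟩ := hx; exact h n x hx
  | zero => exact hz
  | add x y _ _ hx hy => exact ha x y hx hy
  | smul c x _ hx => exact hs c x hx

theorem comul_homog {n : ℤ} {x : Hq q} (hx : Homog q n x) :
    Coalgebra.comul (R := k) x ∈ Submodule.span k
      {t : Hq q ⊗[k] Hq q | ∃ i j u v, i + j = n ∧ Homog q i u ∧ Homog q j v ∧ t = u ⊗ₜ v} := by
  have key : ∀ y : Hq q, Coalgebra.comul (R := k) y = Hq.comulHom q y := fun _ => rfl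
  rw [key]
  induction hx with
  | one =>
    rw [map_one]
    exact Submodule.subset_span ⟨0, 0, 1, 1, rfl, Homog.one, Homog.one, rfl⟩
  | sigma =>
    simp only [Hq.comulHom, Hq.lift_σ]
    exact Submodule.subset_span ⟨0, 0, _, _, rfl, Homog.sigma, Homog.sigma, rfl⟩
  | sigmaInv =>
    simp only [Hq.comulHom, Hq.lift_σinv]
    exact Submodule.subset_span ⟨0, 0, _, _, rfl, Homog.sigmaInv, Homog.sigmaInv, rfl⟩
  | D1 =>
    simp only [Hq.comulHom, Hq.lift_D₁]
    exact Submodule.add_mem _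
      (Submodule.subset_span ⟨1, 0, _, _, rfl, Homog.D1, Homog.sigma, rfl⟩)
      (Submodule.subset_span ⟨0, 1, _, _, rfl, Homog.one, Homog.D1, rfl⟩)
  | D2 =>
    simp only [Hq.comulHom, Hq.lift_D₂]
    exact Submodule.add_mem _
      (Submodule.subset_span ⟨-1, 0, _, _, rfl, Homog.D2, Homog.one, rfl⟩)
      (Submodule.subset_span ⟨0, -1, _, _, rfl, Homog.sigma, Homog.D2, rfl⟩)
  | mul hx hy ihx ihy =>
    rw [map_mul]
    have h := Submodule.mul_mem_mul ihx ihy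
    rw [Submodule.span_mul_span] at h
    refine Submodule.span_mono ?_ h
    rintro _ ⟨_, ⟨i, j, u, v, hij, hu, hv, rfl⟩, _, ⟨i', j', u', v', hij', hu', hv', rfl⟩, rfl⟩
    exact ⟨i + i', j + j', u * u', v * v', by omega, Homog.mul hu hu', Homog.mul hv hv',
      Algebra.TensorProduct.tmul_mul_tmul _ _ _ _⟩

theorem counit_homog {n : ℤ} {x : Hq q} (hx : Homog q n x) :
    n = 0 ∨ Coalgebra.counit (R := k) x = 0 := by
  have key : ∀ y : Hq q, Coalgebra.counit (R := k) y = Hq.counitHom q y := fun _ => rfl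
  rw [key]
  induction hx with
  | one => simp
  | sigma => simp
  | sigmaInv => simp
  | D1 => simp [Hq.counitHom]
  | D2 => simp [Hq.counitHom]
  | mul hx hy ihx ihy =>
    rw [map_mul]
    rcases ihx with h1 | h1
    · rcases ihy with h2 | h2
      · left; omega
      · simp [h2]
    · simp [h1]

theorem D₁_ne_zero : Hq.D₁ q ≠ 0 := by
  have hq : (q : k) ≠ 0 := q.ne_zero
  have hp : ∀ l : ℕ, 2 ≤ l → (!![0, 1; 0, 0] : Matrix (Fin 2) (Fin 2) k) ^ l = 0 := by
    intro l hl
    obtain ⟨m, rfl⟩ := Nat.exists_eq_add_of_le hl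
    rw [pow_add]
    have : (!![0, 1; 0, 0] : Matrix (Fin 2) (Fin 2) k) ^ 2 = 0 := by
      rw [pow_two]; ext i j; fin_cases i <;> fin_cases j <;> simp
    rw [this, zero_mul]
  let F : Hq q →ₐ[k] Matrix (Fin 2) (Fin 2) k :=
    Hq.lift q !![1, 0; 0, (q : k)] !![1, 0; 0, (q : k)⁻¹] !![0, 1; 0, 0] 0
      (by simp)
      (by ext i j; fin_cases i <;> fin_cases j <;> simp)
      (by ext i j; fin_cases i <;> fin_cases j <;> simp)
      (by ext i j; fin_cases i <;> fin_cases j <;> simp)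
      (by simp)
      (fun l hl _ => hp l hl) (fun l hl _ => zero_pow (by omega))
  intro h
  have h1 : F (Hq.D₁ q) = !![0, 1; 0, 0] := Hq.lift_D₁ ..
  rw [h, map_zero] at h1
  have := congrFun (congrFun h1 0) 1
  simp at this

variable (α : A ≃ₐ[k] A)

/-- The algebra map `H_q → End(A ⊗ H_q)` behind the good transposition of `α`. -/
def psi : Hq q →ₐ[k] Module.End k (A ⊗[k] Hq q) :=
  Hq.lift q
    (TensorProduct.map LinearMap.id (LinearMap.mulLeft k (Hq.σ q)))
    (TensorProduct.map LinearMap.id (LinearMap.mulLeft k (Hq.σinv q)))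
    (TensorProduct.map α.toLinearMap (LinearMap.mulLeft k (Hq.D₁ q)))
    (TensorProduct.map α.symm.toLinearMap (LinearMap.mulLeft k (Hq.D₂ q)))
    (by
      refine TensorProduct.ext' fun a h => ?_
      simp [← mul_assoc, Hq.D₁_mul_D₂])
    (by
      refine TensorProduct.ext' fun a h => ?_
      simp [← mul_assoc, Hq.σ_mul_σinv])
    (by
      refine TensorProduct.ext' fun a h => ?_
      simp [← mul_assoc, Hq.σinv_mul_σ])
    (by
      refine TensorProduct.ext' fun a h => ?_
      simp [← mul_assoc, Hq.D₁_mul_σ])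
    (by
      refine TensorProduct.ext' fun a h => ?_
      simp [← mul_assoc, Hq.D₂_mul_σ])
    (fun l hl hq => by
      rw [TensorProduct.map_pow, LinearMap.pow_mulLeft, Hq.D₁_pow q l hl hq]; simp)
    (fun l hl hq => by
      rw [TensorProduct.map_pow, LinearMap.pow_mulLeft, Hq.D₂_pow q l hl hq]; simp)

theorem psi_homog {n : ℤ} {x : Hq q} (hx : Homog q n x) (a : A) (y : Hq q) :
    psi q α x (a ⊗ₜ y) = (α ^ n) a ⊗ₜ (x * y) := by
  induction hx generalizing a y with
  | one => simp
  | sigma => simp [psi]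
  | sigmaInv => simp [psi]
  | D1 => simp [psi]
  | D2 => simp [psi, AlgEquiv.aut_inv]
  | mul hx hy ihx ihy =>
    rw [map_mul, Module.End.mul_apply, ihy, ihx, zpow_add, AlgEquiv.mul_apply, mul_assoc]

/-- The map with `h ⊗ a ↦ αⁿ(a) ⊗ h` for `h` homogeneous of degree `n`. -/
def transOf : Hq q ⊗[k] A →ₗ[k] A ⊗[k] Hq q :=
  TensorProduct.lift (LinearMap.mk₂ k (fun h a => psi q α h (a ⊗ₜ 1))
    (by intros; simp) (by intros; simp) (by intros; simp [TensorProduct.add_tmul])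
    (by intros; simp [← TensorProduct.smul_tmul']))

theorem transOf_homog {n : ℤ} {x : Hq q} (hx : Homog q n x) (a : A) :
    transOf q α (x ⊗ₜ a) = (α ^ n) a ⊗ₜ x := by
  simp [transOf, psi_homog q α hx]

theorem twice_transOf_homog {m n : ℤ} {x y : Hq q} (hx : Homog q m x) (hy : Homog q n y) (a : A) :
    twice (transOf q α) (x ⊗ₜ (y ⊗ₜ a)) = (α ^ (m + n)) a ⊗ₜ (x ⊗ₜ y) := by
  simp [twice, transOf_homog q α hx, transOf_homog q α hy, zpow_add]

theorem transOf_comp : (transOf q α) ∘ₗ (TensorProduct.comm k A (Hq q)).toLinearMap ∘ₗ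
    (transOf q α.symm) ∘ₗ (TensorProduct.comm k A (Hq q)).toLinearMap = LinearMap.id := by
  refine TensorProduct.ext' fun a x => ?_
  refine homog_ind q (f := fun x => ((transOf q α) ∘ₗ (TensorProduct.comm k A (Hq q)).toLinearMap ∘ₗ
    (transOf q α.symm) ∘ₗ (TensorProduct.comm k A (Hq q)).toLinearMap) (a ⊗ₜ x)
      = LinearMap.id (R := k) (a ⊗ₜ x)) ?_ ?_ ?_ ?_ x
  · simp
  · intro x y hx hy
    simp only [TensorProduct.tmul_add, map_add, hx, hy]
  · intro c x hx
    simp only [TensorProduct.tmul_smul, map_smul, hx]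
  · intro n x hx
    simp only [LinearMap.coe_comp, LinearEquiv.coe_coe, Function.comp_apply,
      TensorProduct.comm_tmul, transOf_homog q _ hx, LinearMap.id_coe, id_eq]
    congr 1
    have : α.symm = α⁻¹ := rfl
    rw [this, ← AlgEquiv.mul_apply, inv_zpow, mul_inv_cancel]
    rfl

theorem transOf_bijective : Function.Bijective (transOf q α) := by
  constructor
  · have h := transOf_comp q α.symm
    rw [AlgEquiv.symm_symm] at h
    refine Function.LeftInverse.injective (g := fun y => TensorProduct.comm k A (Hq q)
      (transOf q α.symm (TensorProduct.comm k A (Hq q) y))) fun x => ?_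
    have h2 := LinearMap.congr_fun h (TensorProduct.comm k (Hq q) A x)
    simp only [LinearMap.coe_comp, LinearEquiv.coe_coe, Function.comp_apply, LinearMap.id_coe,
      id_eq] at h2
    have h3 : (TensorProduct.comm k A (Hq q)) ((TensorProduct.comm k (Hq q) A) x) = x :=
      (TensorProduct.comm k (Hq q) A).symm_apply_apply x
    rw [h3] at h2
    change TensorProduct.comm k A (Hq q) (transOf q α.symm _) = x
    rw [h2, h3]
  · intro y
    exact ⟨_, LinearMap.congr_fun (transOf_comp q α) y⟩

theorem transOf_isTransposition : IsTransposition (transOf q α) where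
  bijective := transOf_bijective q α
  one_left a := by simpa using transOf_homog q α Homog.one a
  mul_left h h' a := by
    refine homog_ind q (f := fun h => transOf q α ((h * h') ⊗ₜ a) = LinearMap.lTensor A
      (LinearMap.mul' k (Hq q)) (twice (transOf q α) (h ⊗ₜ (h' ⊗ₜ a)))) (by simp) ?_ ?_ ?_ h
    · intro x y hx hy
      simp only [add_mul, TensorProduct.add_tmul, map_add, hx, hy]
    · intro c x hx
      simp only [smul_mul_assoc, ← TensorProduct.smul_tmul', map_smul, hx]
    intro m x hx
    refine homog_ind q (f := fun h' => transOf q α ((x * h') ⊗ₜ a) = LinearMap.lTensor A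
      (LinearMap.mul' k (Hq q)) (twice (transOf q α) (x ⊗ₜ (h' ⊗ₜ a)))) (by simp) ?_ ?_ ?_ h'
    · intro y z hy hz
      simp only [mul_add, TensorProduct.add_tmul, TensorProduct.tmul_add, map_add, hy, hz]
    · intro c y hy
      simp only [mul_smul_comm, ← TensorProduct.smul_tmul', TensorProduct.tmul_smul, map_smul, hy]
    intro n y hy
    rw [twice_transOf_homog q α hx hy, transOf_homog q α (hx.mul hy)]
    simp
  counit h a := by
    refine homog_ind q (f := fun h => LinearMap.lTensor A (Coalgebra.counit (R := k) (A := Hq q))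
      (transOf q α (h ⊗ₜ a)) = a ⊗ₜ Coalgebra.counit (R := k) h) (by simp) ?_ ?_ ?_ h
    · intro x y hx hy
      simp only [TensorProduct.add_tmul, TensorProduct.tmul_add, map_add, hx, hy]
    · intro c x hx
      simp only [← TensorProduct.smul_tmul', TensorProduct.tmul_smul, map_smul, hx]
    intro n x hx
    rw [transOf_homog q α hx, LinearMap.lTensor_tmul]
    rcases counit_homog q hx with rfl | h0
    · simp
    · simp [h0]
  comul h a := by
    refine homog_ind q (f := fun h => LinearMap.lTensor A (Coalgebra.comul (R := k) (A := Hq q))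
      (transOf q α (h ⊗ₜ a)) = twice (transOf q α) (TensorProduct.assoc k (Hq q) (Hq q) A
        (Coalgebra.comul (R := k) h ⊗ₜ a))) (by simp) ?_ ?_ ?_ h
    · intro x y hx hy
      simp only [TensorProduct.add_tmul, map_add, hx, hy]
    · intro c x hx
      simp only [← TensorProduct.smul_tmul', map_smul, hx]
    intro n x hx
    rw [transOf_homog q α hx, LinearMap.lTensor_tmul]
    have h := comul_homog q hx
    generalize (Coalgebra.comul (R := k) x : Hq q ⊗[k] Hq q) = t at h
    induction h using Submodule.span_induction with
    | mem t ht =>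
      obtain ⟨i, j, u, v, rfl, hu, hv, rfl⟩ := ht
      rw [TensorProduct.assoc_tmul, twice_transOf_homog q α hu hv]
    | zero => simp
    | add s t _ _ hs ht => simp only [TensorProduct.add_tmul, TensorProduct.tmul_add, map_add, hs, ht]
    | smul c t _ ht =>
      simp only [← TensorProduct.smul_tmul', TensorProduct.tmul_smul, map_smul, ht]
  braid h h' a := by
    refine homog_ind q (f := fun h => twice (transOf q α) (h' ⊗ₜ (h ⊗ₜ a)) =
      LinearMap.lTensor A (TensorProduct.comm k (Hq q) (Hq q)).toLinearMap
        (twice (transOf q α) (h ⊗ₜ (h' ⊗ₜ a)))) (by simp) ?_ ?_ ?_ h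
    · intro x y hx hy
      simp only [TensorProduct.add_tmul, TensorProduct.tmul_add, map_add, hx, hy]
    · intro c x hx
      simp only [← TensorProduct.smul_tmul', TensorProduct.tmul_smul, map_smul, hx]
    intro m x hx
    refine homog_ind q (f := fun h' => twice (transOf q α) (h' ⊗ₜ (x ⊗ₜ a)) =
      LinearMap.lTensor A (TensorProduct.comm k (Hq q) (Hq q)).toLinearMap
        (twice (transOf q α) (x ⊗ₜ (h' ⊗ₜ a)))) (by simp) ?_ ?_ ?_ h'
    · intro y z hy hz
      simp only [TensorProduct.add_tmul, TensorProduct.tmul_add, map_add, hy, hz]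
    · intro c y hy
      simp only [← TensorProduct.smul_tmul', TensorProduct.tmul_smul, map_smul, hy]
    intro n y hy
    rw [twice_transOf_homog q α hx hy, twice_transOf_homog q α hy hx, add_comm]
    simp
  one_right h := by
    refine homog_ind q (f := fun h => transOf q α (h ⊗ₜ 1) = 1 ⊗ₜ h) (by simp) ?_ ?_ ?_ h
    · intro x y hx hy
      simp only [TensorProduct.add_tmul, TensorProduct.tmul_add, map_add, hx, hy]
    · intro c x hx
      simp only [← TensorProduct.smul_tmul', TensorProduct.tmul_smul, map_smul, hx]
    intro n x hx
    rw [transOf_homog q α hx, map_one]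
  mul_right h a b := by
    refine homog_ind q (f := fun h => transOf q α (h ⊗ₜ (a * b)) = LinearMap.rTensor (Hq q)
      (LinearMap.mul' k A) (twice' (transOf q α) (h ⊗ₜ (a ⊗ₜ b)))) (by simp) ?_ ?_ ?_ h
    · intro x y hx hy
      simp only [TensorProduct.add_tmul, map_add, hx, hy]
    · intro c x hx
      simp only [← TensorProduct.smul_tmul', map_smul, hx]
    intro n x hx
    simp [twice', transOf_homog q α hx]

theorem transOf_isGood : IsGood q (transOf q α) := by
  intro a
  rw [twice_transOf_homog q α Homog.D1 Homog.D2]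
  simp

theorem transOf_D₁ (a : A) : transOf q α (Hq.D₁ q ⊗ₜ a) = α a ⊗ₜ Hq.D₁ q := by
  simpa using transOf_homog q α Homog.D1 a

theorem D₁_tmul_injective {M : Type*} [AddCommGroup M] [Module k M] :
    Function.Injective (TensorProduct.map α.toLinearMap (TensorProduct.mk k (Hq q) M (Hq.D₁ q))) := by
  obtain ⟨φ, hφ⟩ : ∃ φ : Module.Dual k (Hq q), φ (Hq.D₁ q) = 1 := by
    obtain ⟨ψ, hψ, -⟩ := Submodule.exists_le_ker_of_notMem (p := (⊥ : Submodule k (Hq q)))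
      (v := Hq.D₁ q) (by simpa using D₁_ne_zero q)
    exact ⟨(ψ (Hq.D₁ q))⁻¹ • ψ, by simp [hψ]⟩
  let L : A ⊗[k] (Hq q ⊗[k] M) →ₗ[k] A ⊗[k] M := TensorProduct.map α.symm.toLinearMap
    ((TensorProduct.lid k M).toLinearMap ∘ₗ LinearMap.rTensor M φ)
  have hL : L ∘ₗ TensorProduct.map α.toLinearMap (TensorProduct.mk k (Hq q) M (Hq.D₁ q))
      = LinearMap.id := by
    refine TensorProduct.ext' fun a x => ?_
    simp [L, hφ]
  exact Function.LeftInverse.injective (g := L) fun x => LinearMap.congr_fun hL x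

/-- Every algebra automorphism `α` of `A` comes from exactly one good transposition `s` of `H_q`
on `A`, by `s (D₁ ⊗ a) = α(a) ⊗ D₁`. -/
theorem existsUnique_goodTransposition :
    ∃! s : Hq q ⊗[k] A →ₗ[k] A ⊗[k] Hq q, IsTransposition s ∧ IsGood q s ∧
      ∀ a : A, s (Hq.D₁ q ⊗ₜ a) = α a ⊗ₜ Hq.D₁ q := by
  refine ⟨transOf q α, ⟨transOf_isTransposition q α, transOf_isGood q α, transOf_D₁ q α⟩, ?_⟩
  rintro s ⟨ht, hg, h1⟩
  have hL : ∀ (a : A) (t : A ⊗[k] Hq q), TensorProduct.assoc k A (Hq q) (Hq q)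
      (LinearMap.rTensor (Hq q) s ((TensorProduct.assoc k (Hq q) A (Hq q)).symm
        (Hq.D₁ q ⊗ₜ t)))
      = TensorProduct.map α.toLinearMap (TensorProduct.mk k (Hq q) (Hq q) (Hq.D₁ q)) t := by
    intro a t
    induction t using TensorProduct.induction_on with
    | zero => simp
    | tmul a x => simp [h1]
    | add x y hx hy => simp only [TensorProduct.tmul_add, map_add, hx, hy]
  have hinj := D₁_tmul_injective q α (M := Hq q)
  have htw : ∀ x a, twice s (Hq.D₁ q ⊗ₜ (x ⊗ₜ a))
      = TensorProduct.map α.toLinearMap (TensorProduct.mk k (Hq q) (Hq q) (Hq.D₁ q))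
        (s (x ⊗ₜ a)) := by
    intro x a
    rw [← hL a]
    simp [twice]
  have hσ : ∀ a, s (Hq.σ q ⊗ₜ a) = a ⊗ₜ Hq.σ q := by
    intro a
    have h := ht.comul (Hq.D₁ q) a
    have hc : Coalgebra.comul (R := k) (Hq.D₁ q) = Hq.D₁ q ⊗ₜ Hq.σ q + 1 ⊗ₜ Hq.D₁ q :=
      Hq.lift_D₁ ..
    rw [h1, LinearMap.lTensor_tmul, hc, TensorProduct.add_tmul, map_add, map_add,
      TensorProduct.assoc_tmul, TensorProduct.assoc_tmul, htw] at h
    have h2 : twice s (1 ⊗ₜ (Hq.D₁ q ⊗ₜ a)) = α a ⊗ₜ (1 ⊗ₜ Hq.D₁ q) := by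
      simp [twice, h1, ht.one_left]
    rw [h2, TensorProduct.tmul_add] at h
    refine hinj ?_
    rw [← add_right_cancel h]
    simp
  have hD2 : ∀ a, s (Hq.D₂ q ⊗ₜ a) = α.symm a ⊗ₜ Hq.D₂ q := by
    intro a
    have h := hg a
    rw [htw] at h
    refine hinj ?_
    rw [h]
    simp
  have hL2 : ∀ t : A ⊗[k] Hq q, LinearMap.lTensor A (LinearMap.mul' k (Hq q))
      (TensorProduct.assoc k A (Hq q) (Hq q)
      (LinearMap.rTensor (Hq q) s ((TensorProduct.assoc k (Hq q) A (Hq q)).symm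
        (Hq.σ q ⊗ₜ t)))) = LinearMap.lTensor A (LinearMap.mulLeft k (Hq.σ q)) t := by
    intro t
    induction t using TensorProduct.induction_on with
    | zero => simp
    | tmul a x => simp [hσ]
    | add x y hx hy => simp only [TensorProduct.tmul_add, map_add, hx, hy]
  have hσinv : ∀ a, s (Hq.σinv q ⊗ₜ a) = a ⊗ₜ Hq.σinv q := by
    intro a
    have h := ht.mul_left (Hq.σ q) (Hq.σinv q) a
    rw [Hq.σ_mul_σinv, ht.one_left] at h
    have h3 : a ⊗ₜ[k] (1 : Hq q) = LinearMap.lTensor A (LinearMap.mulLeft k (Hq.σ q))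
        (s (Hq.σinv q ⊗ₜ a)) := by
      rw [h, ← hL2]; simp [twice]
    have h4 := congrArg (LinearMap.lTensor A (LinearMap.mulLeft k (Hq.σinv q))) h3
    rw [← LinearMap.comp_apply, ← LinearMap.lTensor_comp] at h4
    have h5 : LinearMap.mulLeft k (Hq.σinv q) ∘ₗ LinearMap.mulLeft k (Hq.σ q)
        = LinearMap.id := by
      ext x
      simp [← mul_assoc, Hq.σinv_mul_σ]
    rw [h5] at h4
    simpa using h4.symm
  have hall : ∀ n x, Homog q n x → ∀ a, s (x ⊗ₜ a) = (α ^ n) a ⊗ₜ x := by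
    intro n x hx
    induction hx with
    | one => intro a; simpa using ht.one_left a
    | sigma => intro a; simpa using hσ a
    | sigmaInv => intro a; simpa using hσinv a
    | D1 => intro a; simpa using h1 a
    | D2 => intro a; simpa using hD2 a
    | mul hx hy ihx ihy =>
      intro a
      rw [ht.mul_left]
      simp [twice, ihx, ihy, zpow_add]
  refine TensorProduct.ext' fun x a => ?_
  refine homog_ind q (f := fun x => s (x ⊗ₜ a) = transOf q α (x ⊗ₜ a)) (by simp) ?_ ?_ ?_ x
  · intro x y hx hy
    simp only [TensorProduct.add_tmul, map_add, hx, hy]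
  · intro c x hx
    simp only [← TensorProduct.smul_tmul', map_smul, hx]
  · intro n x hx
    rw [hall n x hx, transOf_homog q α hx]

/-- The good transposition associated with an algebra automorphism `α`. -/
def goodTransposition : Hq q ⊗[k] A →ₗ[k] A ⊗[k] Hq q :=
  (existsUnique_goodTransposition q α).choose

theorem goodTransposition_spec :
    IsTransposition (goodTransposition q α) ∧ IsGood q (goodTransposition q α) ∧
      ∀ a : A, goodTransposition q α (Hq.D₁ q ⊗ₜ a) = α a ⊗ₜ Hq.D₁ q :=
  (existsUnique_goodTransposition q α).choose_spec.1

end Hq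

end Braided

/-! ### Crossed products `S(V) #_f G` -/

/-- A normal (normalized) 2-cocycle of `G` with values in `kˣ` (trivial action). -/
structure NormalCocycle (G k : Type*) [Group G] [Field k] where
  toFun : G → G → kˣ
  one_left : ∀ g, toFun 1 g = 1
  one_right : ∀ g, toFun g 1 = 1
  cocycle : ∀ g h l, toFun g h * toFun (g * h) l = toFun h l * toFun g (h * l)

instance {G k : Type*} [Group G] [Field k] : CoeFun (NormalCocycle G k) (fun _ => G → G → kˣ) :=
  ⟨NormalCocycle.toFun⟩

section sym

variable {k V : Type*} [Field k] [AddCommGroup V] [Module k V]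

/-- The endomorphism of `S(V)` extending a linear endomorphism of `V`. -/
def symMap (φ : V →ₗ[k] V) : SymmetricAlgebra k V →ₐ[k] SymmetricAlgebra k V :=
  SymmetricAlgebra.lift (SymmetricAlgebra.ι k V ∘ₗ φ)

@[simp] theorem symMap_ι (φ : V →ₗ[k] V) (v : V) :
    symMap φ (SymmetricAlgebra.ι k V v) = SymmetricAlgebra.ι k V (φ v) := by
  simp [symMap]

theorem symMap_comp (φ ψ : V →ₗ[k] V) (P : SymmetricAlgebra k V) :
    symMap φ (symMap ψ P) = symMap (φ ∘ₗ ψ) P := by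
  have : (symMap φ).comp (symMap ψ) = symMap (φ ∘ₗ ψ) := by
    ext v; simp
  exact DFunLike.congr_fun this P

theorem symMap_id (P : SymmetricAlgebra k V) : symMap (LinearMap.id : V →ₗ[k] V) P = P := by
  have : symMap (LinearMap.id : V →ₗ[k] V) = AlgHom.id k _ := by
    ext v; simp
  exact DFunLike.congr_fun this P

/-- A linear map from `V` with pairwise commuting values extends to `S(V)`. -/
theorem exists_symLift {B : Type*} [Ring B] [Algebra k B] (F : V →ₗ[k] B)
    (hF : ∀ v w, F v * F w = F w * F v) :
    ∃ T : SymmetricAlgebra k V →ₐ[k] B, ∀ v, T (SymmetricAlgebra.ι k V v) = F v := by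
  let i : CommSemiring (Algebra.adjoin k (Set.range F)) :=
    { (Algebra.adjoin k (Set.range F)).toSemiring with
      mul_comm := (Algebra.isMulCommutative_adjoin k (by
        rintro _ ⟨v, rfl⟩ _ ⟨w, rfl⟩; exact hF v w)).is_comm.comm }
  let F' : V →ₗ[k] Algebra.adjoin k (Set.range F) :=
    LinearMap.codRestrict (Subalgebra.toSubmodule (Algebra.adjoin k (Set.range F))) F
      (fun v => Algebra.subset_adjoin ⟨v, rfl⟩)
  refine ⟨(Algebra.adjoin k (Set.range F)).val.comp (SymmetricAlgebra.lift F'), fun v => ?_⟩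
  rw [AlgHom.comp_apply, SymmetricAlgebra.lift_ι_apply]
  rfl

end sym

/-- The crossed product `A = S(V) #_f G`: the free left `S(V)`-module with basis `w_g`, `g ∈ G`;
`Finsupp.single g P` is `P w_g`. -/
def CrossedProduct {k G V : Type*} [Field k] [Group G] [AddCommGroup V] [Module k V]
    (_ρ : Representation k G V) (_f : NormalCocycle G k) : Type _ :=
  G →₀ SymmetricAlgebra k V

namespace CrossedProduct

variable {k G V : Type*} [Field k] [Group G] [AddCommGroup V] [Module k V]
  (ρ : Representation k G V) (f : NormalCocycle G k)

instance : AddCommGroup (CrossedProduct ρ f) :=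
  inferInstanceAs (AddCommGroup (G →₀ SymmetricAlgebra k V))

instance : Module k (CrossedProduct ρ f) :=
  inferInstanceAs (Module k (G →₀ SymmetricAlgebra k V))

/-- `P ↦ P w_g`. -/
def sing (g : G) : SymmetricAlgebra k V →ₗ[k] CrossedProduct ρ f :=
  Finsupp.lsingle (R := k) g

/-- The linear map with prescribed values on the `P w_g`. -/
def lin {M : Type*} [AddCommGroup M] [Module k M] (F : G → SymmetricAlgebra k V →ₗ[k] M) :
    CrossedProduct ρ f →ₗ[k] M :=
  Finsupp.lsum k F

@[simp] theorem lin_sing {M : Type*} [AddCommGroup M] [Module k M]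
    (F : G → SymmetricAlgebra k V →ₗ[k] M) (g : G) (P : SymmetricAlgebra k V) :
    lin ρ f F (sing ρ f g P) = F g P := by
  change Finsupp.lsum k F (Finsupp.single g P) = _
  simp

variable {ρ f} in
theorem lin_ext {M : Type*} [AddCommGroup M] [Module k M] {F F' : CrossedProduct ρ f →ₗ[k] M}
    (h : ∀ g P, F (sing ρ f g P) = F' (sing ρ f g P)) : F = F' :=
  Finsupp.lhom_ext h

/-- The product, `(P w_g) (Q w_h) = P (g • Q) f(g, h) w_{gh}`. -/
def mulL : CrossedProduct ρ f →ₗ[k] CrossedProduct ρ f →ₗ[k] CrossedProduct ρ f :=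
  lin ρ f fun g => LinearMap.flip <| lin ρ f fun h => LinearMap.flip <|
    ((LinearMap.mul k (SymmetricAlgebra k V)).compl₂ (symMap (ρ g)).toLinearMap).compr₂
      ((f g h : k) • sing ρ f (g * h))

theorem mulL_sing (g h : G) (P Q : SymmetricAlgebra k V) :
    mulL ρ f (sing ρ f g P) (sing ρ f h Q) =
      (f g h : k) • sing ρ f (g * h) (P * symMap (ρ g) Q) := by
  simp [mulL]

theorem mulL_assoc (x y z : CrossedProduct ρ f) :
    mulL ρ f (mulL ρ f x y) z = mulL ρ f x (mulL ρ f y z) := by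
  have h : (mulL ρ f).compr₂ (mulL ρ f)
      = ((LinearMap.llcomp k (CrossedProduct ρ f) (CrossedProduct ρ f)
          (CrossedProduct ρ f)).flip ∘ₗ (mulL ρ f)).flip ∘ₗ (mulL ρ f) := by
    refine lin_ext fun g P => lin_ext fun h Q => lin_ext fun l R => ?_
    have h0 : symMap (ρ g) (Q * symMap (ρ h) R)
        = symMap (ρ g) Q * symMap (ρ g ∘ₗ ρ h) R := by rw [map_mul, symMap_comp]
    simp only [LinearMap.compr₂_apply, LinearMap.flip_apply, LinearMap.comp_apply,
      LinearMap.llcomp_apply, mulL_sing, map_smul, LinearMap.smul_apply, smul_smul, h0]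
    have h1 : symMap (ρ (g * h)) = symMap (ρ g ∘ₗ ρ h) := by rw [map_mul]; rfl
    have h2 : (f g h : k) * f (g * h) l = f h l * f g (h * l) := by
      exact_mod_cast congrArg Units.val (f.cocycle g h l)
    rw [h1, h2, mul_assoc g h l, mul_assoc P]
  exact LinearMap.congr_fun (LinearMap.congr_fun (LinearMap.congr_fun h x) y) z

theorem one_mulL (x : CrossedProduct ρ f) : mulL ρ f (sing ρ f 1 1) x = x := by
  have h : mulL ρ f (sing ρ f 1 1) = LinearMap.id := by
    refine lin_ext fun g P => ?_
    have : ρ 1 = (LinearMap.id : V →ₗ[k] V) := by rw [map_one]; rfl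
    simp [mulL_sing, f.one_left, this, symMap_id]
  exact LinearMap.congr_fun h x

theorem mulL_one (x : CrossedProduct ρ f) : mulL ρ f x (sing ρ f 1 1) = x := by
  have h : (mulL ρ f).flip (sing ρ f 1 1) = LinearMap.id := by
    refine lin_ext fun g P => ?_
    simp [mulL_sing, f.one_right]
  exact LinearMap.congr_fun h x

instance : Ring (CrossedProduct ρ f) where
  __ := (inferInstance : AddCommGroup (CrossedProduct ρ f))
  mul x y := mulL ρ f x y
  one := sing ρ f 1 1
  mul_assoc := mulL_assoc ρ f
  one_mul := one_mulL ρ f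
  mul_one := mulL_one ρ f
  left_distrib x y z := map_add (mulL ρ f x) y z
  right_distrib x y z := LinearMap.map_add₂ (mulL ρ f) x y z
  zero_mul x := LinearMap.map_zero₂ (mulL ρ f) x
  mul_zero x := map_zero (mulL ρ f x)

theorem sing_mul_sing (g h : G) (P Q : SymmetricAlgebra k V) :
    sing ρ f g P * sing ρ f h Q = (f g h : k) • sing ρ f (g * h) (P * symMap (ρ g) Q) :=
  mulL_sing ρ f g h P Q

theorem one_def : (1 : CrossedProduct ρ f) = sing ρ f 1 1 := rfl

instance : Algebra k (CrossedProduct ρ f) :=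
  Algebra.ofModule (fun c x y => LinearMap.map_smul₂ (mulL ρ f) c x y)
    (fun c x y => map_smul (mulL ρ f x) c y)

/-- The basis element `w_g`. -/
def w (g : G) : CrossedProduct ρ f := sing ρ f g 1

/-- The inclusion `S(V) → A`. -/
def ofS : SymmetricAlgebra k V →ₐ[k] CrossedProduct ρ f :=
  AlgHom.ofLinearMap (sing ρ f 1) rfl (fun P Q => by
    have : ρ 1 = (LinearMap.id : V →ₗ[k] V) := by rw [map_one]; rfl
    simp [sing_mul_sing, f.one_left, this, symMap_id])

/-- The inclusion `V → A`. -/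
def ofV : V →ₗ[k] CrossedProduct ρ f := (ofS ρ f).toLinearMap ∘ₗ SymmetricAlgebra.ι k V

theorem ofS_apply (P : SymmetricAlgebra k V) : ofS ρ f P = sing ρ f 1 P := rfl

theorem ofV_apply (v : V) : ofV ρ f v = ofS ρ f (SymmetricAlgebra.ι k V v) := rfl

theorem ofS_mul_w (P : SymmetricAlgebra k V) (g : G) : ofS ρ f P * w ρ f g = sing ρ f g P := by
  simp [ofS_apply, w, sing_mul_sing, f.one_left]

theorem w_mul_ofS (P : SymmetricAlgebra k V) (g : G) :
    w ρ f g * ofS ρ f P = ofS ρ f (symMap (ρ g) P) * w ρ f g := by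
  rw [ofS_mul_w]
  simp [ofS_apply, w, sing_mul_sing, f.one_right]

/-- The linear map `v₁ ⋯ vₘ w_g ↦ φ(v₁) ⋯ φ(vₘ) χ(g) w_g`. -/
def diag (φ : V →ₗ[k] V) (χ : G →* kˣ) : CrossedProduct ρ f →ₗ[k] CrossedProduct ρ f :=
  lin ρ f fun g => (χ g : k) • (sing ρ f g ∘ₗ (symMap φ).toLinearMap)

theorem diag_sing (φ : V →ₗ[k] V) (χ : G →* kˣ) (g : G) (P : SymmetricAlgebra k V) :
    diag ρ f φ χ (sing ρ f g P) = (χ g : k) • sing ρ f g (symMap φ P) := by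
  simp [diag]

/-- `diag φ χ` is multiplicative if `φ` commutes with the action of `G`. -/
def diagHom (φ : V →ₗ[k] V) (hφ : ∀ g v, φ (ρ g v) = ρ g (φ v)) (χ : G →* kˣ) :
    CrossedProduct ρ f →ₐ[k] CrossedProduct ρ f :=
  AlgHom.ofLinearMap (diag ρ f φ χ)
    (by simp [one_def, diag_sing])
    (by
      intro x y
      have h : (LinearMap.mul k (CrossedProduct ρ f)).compr₂ (diag ρ f φ χ)
          = (LinearMap.mul k (CrossedProduct ρ f)).compl₁₂ (diag ρ f φ χ) (diag ρ f φ χ) := by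
        refine lin_ext fun g P => lin_ext fun h Q => ?_
        have h1 : φ ∘ₗ ρ g = ρ g ∘ₗ φ := LinearMap.ext (hφ g)
        have h2 : ((χ (g * h) : kˣ) : k) = χ g * χ h := by rw [map_mul, Units.val_mul]
        rw [LinearMap.compr₂_apply, LinearMap.mul_apply', LinearMap.compl₁₂_apply,
          LinearMap.mul_apply', sing_mul_sing, map_smul, diag_sing, diag_sing, diag_sing, h2,
          map_mul, symMap_comp, h1, smul_mul_smul_comm, sing_mul_sing, smul_smul, smul_smul,
          symMap_comp, mul_comm]
      exact LinearMap.congr_fun (LinearMap.congr_fun h x) y)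

/-- The algebra automorphism of `A` determined by a bijective `k[G]`-linear map `φ : V → V` and a
group homomorphism `χ : G → kˣ`: `v₁ ⋯ vₘ w_g ↦ φ(v₁) ⋯ φ(vₘ) χ(g) w_g`. -/
def auto (φ : V ≃ₗ[k] V) (hφ : ∀ g v, φ (ρ g v) = ρ g (φ v)) (χ : G →* kˣ) :
    CrossedProduct ρ f ≃ₐ[k] CrossedProduct ρ f :=
  AlgEquiv.ofAlgHom (diagHom ρ f φ.toLinearMap hφ χ)
    (diagHom ρ f φ.symm.toLinearMap (fun g v => by
      apply φ.injective; simp [hφ]) χ⁻¹)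
    (by
      apply AlgHom.toLinearMap_injective
      refine lin_ext fun g P => ?_
      change diag ρ f φ.toLinearMap χ (diag ρ f φ.symm.toLinearMap χ⁻¹ (sing ρ f g P)) = _
      simp [diag_sing, symMap_comp, symMap_id])
    (by
      apply AlgHom.toLinearMap_injective
      refine lin_ext fun g P => ?_
      change diag ρ f φ.symm.toLinearMap χ⁻¹ (diag ρ f φ.toLinearMap χ (sing ρ f g P)) = _
      simp [diag_sing, symMap_comp, symMap_id])

theorem auto_sing (φ : V ≃ₗ[k] V) (hφ : ∀ g v, φ (ρ g v) = ρ g (φ v)) (χ : G →* kˣ) (g : G)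
    (P : SymmetricAlgebra k V) :
    auto ρ f φ hφ χ (sing ρ f g P) = (χ g : k) • sing ρ f g (symMap φ.toLinearMap P) :=
  diag_sing ρ f _ χ g P

theorem auto_symm_sing (φ : V ≃ₗ[k] V) (hφ : ∀ g v, φ (ρ g v) = ρ g (φ v)) (χ : G →* kˣ) (g : G)
    (P : SymmetricAlgebra k V) :
    (auto ρ f φ hφ χ).symm (sing ρ f g P)
      = (χ⁻¹ g : k) • sing ρ f g (symMap φ.symm.toLinearMap P) :=
  (diag_sing ρ f _ χ⁻¹ g P).trans (by simp)

/-- The product `v₁ ⋯ vₘ` in `A`. -/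
def vprod (vs : List V) : CrossedProduct ρ f := (vs.map (ofV ρ f)).prod

theorem vprod_eq (vs : List V) :
    vprod ρ f vs = ofS ρ f (vs.map (SymmetricAlgebra.ι k V)).prod := by
  rw [vprod, map_list_prod, List.map_map]
  rfl

theorem span_vprod : Submodule.span k
    {x : CrossedProduct ρ f | ∃ vs g, x = vprod ρ f vs * w ρ f g} = ⊤ := by
  set p := Submodule.span k {x : CrossedProduct ρ f | ∃ vs g, x = vprod ρ f vs * w ρ f g} with hp
  have key : ∀ P : SymmetricAlgebra k V, P ∈ Submodule.span k
      {P | ∃ vs : List V, P = (vs.map (SymmetricAlgebra.ι k V)).prod} := by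
    intro P
    induction P using SymmetricAlgebra.induction with
    | algebraMap r =>
      rw [Algebra.algebraMap_eq_smul_one]
      exact Submodule.smul_mem _ _ (Submodule.subset_span ⟨[], by simp⟩)
    | ι v => exact Submodule.subset_span ⟨[v], by simp⟩
    | mul a b ha hb =>
      have h := Submodule.mul_mem_mul ha hb
      rw [Submodule.span_mul_span] at h
      refine Submodule.span_mono ?_ h
      rintro _ ⟨_, ⟨u, rfl⟩, _, ⟨v, rfl⟩, rfl⟩
      exact ⟨u ++ v, by simp⟩
    | add a b ha hb => exact Submodule.add_mem _ ha hb
  have h2 : p.mkQ = 0 := by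
    refine lin_ext fun g P => ?_
    simp only [LinearMap.zero_apply, Submodule.mkQ_apply, Submodule.Quotient.mk_eq_zero]
    have := key P
    induction this using Submodule.span_induction with
    | mem P hP =>
      obtain ⟨vs, rfl⟩ := hP
      exact Submodule.subset_span ⟨vs, g, by rw [vprod_eq, ofS_mul_w]⟩
    | zero => simp
    | add x y _ _ hx hy => rw [map_add]; exact Submodule.add_mem _ hx hy
    | smul c x _ hx => rw [map_smul]; exact Submodule.smul_mem _ _ hx
  rw [← Submodule.ker_mkQ p, h2, LinearMap.ker_zero]

/-- Existence and uniqueness of skew derivations on `A` with prescribed values on `V`. -/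
theorem existsUnique_skew (a c : V →ₗ[k] V) (d : V →ₗ[k] CrossedProduct ρ f)
    (N : G → CrossedProduct ρ f)
    (h : ∀ v w, d v * ofV ρ f (c w) + ofV ρ f (a v) * d w
      = d w * ofV ρ f (c v) + ofV ρ f (a w) * d v) :
    ∃! δ : CrossedProduct ρ f →ₗ[k] CrossedProduct ρ f, ∀ (vs : List V) (g : G),
      δ (vprod ρ f vs * w ρ f g) = ∑ j : Fin vs.length,
        vprod ρ f ((vs.take j).map a) * d (vs.get j) *
          (vprod ρ f ((vs.drop (j + 1)).map c) * N g) := by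
  refine existsUnique_of_exists_of_unique ?_ ?_
  · let F : V →ₗ[k] Matrix (Fin 2) (Fin 2) (CrossedProduct ρ f) :=
      { toFun := fun v => !![ofV ρ f (a v), d v; 0, ofV ρ f (c v)]
        map_add' := fun v w => by
          ext i j; fin_cases i <;> fin_cases j <;> simp
        map_smul' := fun r v => by
          ext i j; fin_cases i <;> fin_cases j <;> simp }
    have hcomm : ∀ v w : V, ofV ρ f v * ofV ρ f w = ofV ρ f w * ofV ρ f v := by
      intro v w
      rw [ofV_apply, ofV_apply, ← map_mul (ofS ρ f), ← map_mul (ofS ρ f), mul_comm]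
    have hF : ∀ v w, F v * F w = F w * F v := by
      intro v w
      ext i j
      fin_cases i <;> fin_cases j
      · simp [F, Matrix.mul_apply, hcomm (a v)]
      · simp only [F, LinearMap.coe_mk, AddHom.coe_mk, Matrix.mul_apply, Fin.sum_univ_two]
        simpa [add_comm] using h v w
      · simp [F, Matrix.mul_apply]
      · simp [F, Matrix.mul_apply, hcomm (c v)]
    obtain ⟨T, hT⟩ := exists_symLift F hF
    have hprod : ∀ vs : List V,
        T (vs.map (SymmetricAlgebra.ι k V)).prod 1 1 = vprod ρ f (vs.map c) ∧
        T (vs.map (SymmetricAlgebra.ι k V)).prod 0 1 = ∑ j : Fin vs.length,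
          vprod ρ f ((vs.take j).map a) * d (vs.get j) * vprod ρ f ((vs.drop (j + 1)).map c) := by
      intro vs
      induction vs with
      | nil => simp [vprod]
      | cons v vs ih =>
        obtain ⟨ih1, ih2⟩ := ih
        rw [List.map_cons, List.prod_cons, map_mul, hT]
        constructor
        · rw [Matrix.mul_apply, Fin.sum_univ_two, ih1]
          simp [F, vprod]
        · rw [Matrix.mul_apply, Fin.sum_univ_two, ih1, ih2]
          simp only [List.length_cons]
          rw [Fin.sum_univ_succ, add_comm]
          simp [F, vprod, Finset.mul_sum, mul_assoc]
    let E : SymmetricAlgebra k V →ₗ[k] CrossedProduct ρ f :=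
      { toFun := fun P => T P 0 1
        map_add' := fun P Q => by simp
        map_smul' := fun r P => by simp }
    refine ⟨lin ρ f fun g => LinearMap.mulRight k (N g) ∘ₗ E, fun vs g => ?_⟩
    rw [vprod_eq, ofS_mul_w, lin_sing]
    change T _ 0 1 * N g = _
    rw [(hprod vs).2, Finset.sum_mul]
    simp only [mul_assoc]
  · intro δ δ' h1 h2
    refine LinearMap.ext_on (span_vprod ρ f) ?_
    rintro _ ⟨vs, g, rfl⟩
    rw [h1, h2]

end CrossedProduct

/-! ### The explicit setup -/

section linear

variable {k V : Type*} [Field k] [AddCommGroup V] [Module k V]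

/-- For a subspace `W` of codimension `1` and `x ∉ W` there is exactly one linear functional
which vanishes on `W` and takes the value `1` at `x`. -/
theorem existsUnique_coord (W : Submodule k V) (hW : Module.finrank k (V ⧸ W) = 1) (x : V)
    (hx : x ∉ W) : ∃! φ : V →ₗ[k] k, LinearMap.ker φ = W ∧ φ x = 1 := by
  obtain ⟨ψ, hψ, hker⟩ := Submodule.exists_le_ker_of_notMem hx
  have hdec : ∀ v : V, ∃ c : k, v - c • x ∈ W := by
    intro v
    have hx' : W.mkQ x ≠ 0 := by simpa using hx
    obtain ⟨c, hc⟩ := (finrank_eq_one_iff_of_nonzero' (W.mkQ x) hx').1 hW (W.mkQ v)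
    refine ⟨c, ?_⟩
    rw [← Submodule.Quotient.mk_eq_zero, ← Submodule.mkQ_apply, map_sub, map_smul, hc, sub_self]
  refine ⟨(ψ x)⁻¹ • ψ, ⟨?_, ?_⟩, ?_⟩
  · ext v
    simp only [LinearMap.mem_ker, LinearMap.smul_apply, smul_eq_mul, mul_eq_zero, inv_eq_zero, hψ,
      false_or]
    refine ⟨fun hv => ?_, fun hv => hker hv⟩
    obtain ⟨c, hc⟩ := hdec v
    have h1 : ψ (v - c • x) = 0 := hker hc
    rw [map_sub, hv, map_smul, smul_eq_mul, zero_sub, neg_eq_zero, mul_eq_zero] at h1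
    rw [h1.resolve_right hψ, zero_smul, sub_zero] at hc
    exact hc
  · simp [hψ]
  · rintro φ ⟨h1, h2⟩
    ext v
    obtain ⟨c, hc⟩ := hdec v
    have e1 : φ (v - c • x) = 0 := by rw [← LinearMap.mem_ker, h1]; exact hc
    have e2 : ψ (v - c • x) = 0 := hker hc
    rw [map_sub, map_smul, sub_eq_zero] at e1 e2
    rw [e1, LinearMap.smul_apply, e2, h2]
    simp [mul_comm, hψ]

end linear

/-- The data: a representation `ρ` of `G` on `V`, a normal cocycle `f`, a bijective
`k[G]`-linear map `αhat`, characters `χα`, `χς`, distinct `αhat`-stable `G`-submodules `V₁`, `V₂`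
of codimension `1`, central elements `g₁`, `g₂` such that `g₁⁻¹` and `g₂` act in the same way on
`V₁ ∩ V₂`, vectors `x₁ ∈ V₂ ∖ V₁`, `x₂ ∈ V₁ ∖ V₂`, and nonzero `P₁ ∈ S(V₁)`, `P₂ ∈ S(V₂)`. -/
structure FirstCase (k G V : Type*) [Field k] [Group G] [AddCommGroup V] [Module k V] where
  ρ : Representation k G V
  f : NormalCocycle G k
  αhat : V ≃ₗ[k] V
  αhat_equivariant : ∀ g v, αhat (ρ g v) = ρ g (αhat v)
  χα : G →* kˣ
  V₁ : Submodule k V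
  V₂ : Submodule k V
  V₁_ne_V₂ : V₁ ≠ V₂
  codim₁ : Module.finrank k (V ⧸ V₁) = 1
  codim₂ : Module.finrank k (V ⧸ V₂) = 1
  G_stable₁ : ∀ g, ∀ v ∈ V₁, ρ g v ∈ V₁
  G_stable₂ : ∀ g, ∀ v ∈ V₂, ρ g v ∈ V₂
  αhat_stable₁ : ∀ v ∈ V₁, αhat v ∈ V₁
  αhat_stable₂ : ∀ v ∈ V₂, αhat v ∈ V₂
  g₁ : G
  g₂ : G
  g₁_central : g₁ ∈ Subgroup.center G
  g₂_central : g₂ ∈ Subgroup.center G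
  inter : ∀ v, v ∈ V₁ → v ∈ V₂ → ρ g₁⁻¹ v = ρ g₂ v
  χς : G →* kˣ
  x₁ : V
  x₂ : V
  x₁_mem : x₁ ∈ V₂
  x₁_notMem : x₁ ∉ V₁
  x₂_mem : x₂ ∈ V₁
  x₂_notMem : x₂ ∉ V₂
  P₁ : SymmetricAlgebra k V
  P₂ : SymmetricAlgebra k V
  P₁_mem : P₁ ∈ Algebra.adjoin k (SymmetricAlgebra.ι k V '' (V₁ : Set V))
  P₂_mem : P₂ ∈ Algebra.adjoin k (SymmetricAlgebra.ι k V '' (V₂ : Set V))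
  P₁_ne_zero : P₁ ≠ 0
  P₂_ne_zero : P₂ ≠ 0

namespace FirstCase

variable {k G V : Type*} [Field k] [Group G] [AddCommGroup V] [Module k V] (D : FirstCase k G V)

/-- The crossed product `A = S(V) #_f G`. -/
abbrev A : Type _ := CrossedProduct D.ρ D.f

/-- The basis element `w_g` of `A`. -/
abbrev w (g : G) : D.A := CrossedProduct.w D.ρ D.f g

/-- The inclusion `S(V) → A`. -/
abbrev ofS : SymmetricAlgebra k V →ₐ[k] D.A := CrossedProduct.ofS D.ρ D.f

/-- The inclusion `V → A`. -/
abbrev ofV : V →ₗ[k] D.A := CrossedProduct.ofV D.ρ D.f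

/-- The product `v₁ ⋯ vₘ` in `A`. -/
abbrev vprod (vs : List V) : D.A := CrossedProduct.vprod D.ρ D.f vs

/-- The automorphism `α` of `A` induced by `αhat` and `χα`. -/
def α : D.A ≃ₐ[k] D.A := CrossedProduct.auto D.ρ D.f D.αhat D.αhat_equivariant D.χα

/-- The good transposition `s` associated with `α`. -/
def s (q : kˣ) : Hq q ⊗[k] D.A →ₗ[k] D.A ⊗[k] Hq q := Braided.goodTransposition q D.α

/-- The linear functional with kernel `V₁` and value `1` at `x₁`; thus `v - coord₁ v • x₁ ∈ V₁`. -/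
def coord₁ : V →ₗ[k] k := (existsUnique_coord D.V₁ D.codim₁ D.x₁ D.x₁_notMem).choose

/-- The linear functional with kernel `V₂` and value `1` at `x₂`; thus `v - coord₂ v • x₂ ∈ V₂`. -/
def coord₂ : V →ₗ[k] k := (existsUnique_coord D.V₂ D.codim₂ D.x₂ D.x₂_notMem).choose

theorem coord₁_spec : LinearMap.ker D.coord₁ = D.V₁ ∧ D.coord₁ D.x₁ = 1 :=
  (existsUnique_coord D.V₁ D.codim₁ D.x₁ D.x₁_notMem).choose_spec.1

theorem coord₂_spec : LinearMap.ker D.coord₂ = D.V₂ ∧ D.coord₂ D.x₂ = 1 :=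
  (existsUnique_coord D.V₂ D.codim₂ D.x₂ D.x₂_notMem).choose_spec.1

theorem coord₁_eq_zero {v : V} : D.coord₁ v = 0 ↔ v ∈ D.V₁ := by
  rw [← LinearMap.mem_ker, D.coord₁_spec.1]

theorem coord₂_eq_zero {v : V} : D.coord₂ v = 0 ↔ v ∈ D.V₂ := by
  rw [← LinearMap.mem_ker, D.coord₂_spec.1]

/-- `coord₁ v` is the scalar `c` with `v - c x₁ ∈ V₁`. -/
theorem coord₁_eq_iff {v : V} {c : k} : D.coord₁ v = c ↔ v - c • D.x₁ ∈ D.V₁ := by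
  rw [← coord₁_eq_zero, map_sub, map_smul, D.coord₁_spec.2, smul_eq_mul, mul_one, sub_eq_zero]

/-- `coord₂ v` is the scalar `c` with `v - c x₂ ∈ V₂`. -/
theorem coord₂_eq_iff {v : V} {c : k} : D.coord₂ v = c ↔ v - c • D.x₂ ∈ D.V₂ := by
  rw [← coord₂_eq_zero, map_sub, map_smul, D.coord₂_spec.2, smul_eq_mul, mul_one, sub_eq_zero]

/-- `λ_{1g}`, defined by `g • x₁ - λ_{1g} x₁ ∈ V₁`. -/
def lam₁ (g : G) : k := D.coord₁ (D.ρ g D.x₁)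

/-- `λ_{2g}`, defined by `g • x₂ - λ_{2g} x₂ ∈ V₂`. -/
def lam₂ (g : G) : k := D.coord₂ (D.ρ g D.x₂)

/-- `ν₁`, defined by `αhat x₁ - ν₁ x₁ ∈ V₁`. -/
def ν₁ : k := D.coord₁ (D.αhat D.x₁)

/-- `ν₂`, defined by `αhat x₂ - ν₂ x₂ ∈ V₂`. -/
def ν₂ : k := D.coord₂ (D.αhat D.x₂)

/-- There is exactly one linear map which is `αhat ∘ g₁⁻¹` on `V₁` and `αhat ∘ g₂` on `V₂`. -/
theorem existsUnique_ςhat : ∃! ς : V →ₗ[k] V,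
    (∀ v ∈ D.V₁, ς v = D.αhat (D.ρ D.g₁⁻¹ v)) ∧ (∀ v ∈ D.V₂, ς v = D.αhat (D.ρ D.g₂ v)) := by
  have hmem : ∀ v, v - D.coord₁ v • D.x₁ ∈ D.V₁ := fun v => D.coord₁_eq_iff.1 rfl
  refine ⟨D.αhat.toLinearMap ∘ₗ (D.ρ D.g₁⁻¹ ∘ₗ
    (LinearMap.id - D.coord₁.smulRight D.x₁) + D.coord₁.smulRight (D.ρ D.g₂ D.x₁)),
    ⟨fun v hv => ?_, fun v hv => ?_⟩, ?_⟩
  · simp [D.coord₁_eq_zero.2 hv]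
  · have h := D.inter _ (hmem v) (D.V₂.sub_mem hv (D.V₂.smul_mem _ D.x₁_mem))
    simp only [LinearMap.comp_apply, LinearMap.add_apply, LinearMap.sub_apply, LinearMap.id_apply,
      LinearMap.smulRight_apply, LinearEquiv.coe_coe]
    rw [h]
    simp
  · rintro ς ⟨h1, h2⟩
    ext v
    have e : v = (v - D.coord₁ v • D.x₁) + D.coord₁ v • D.x₁ := by abel
    have e1 : ς v = ς (v - D.coord₁ v • D.x₁) + D.coord₁ v • ς D.x₁ := by
      rw [← map_smul, ← map_add]; congr 1
    rw [e1, h1 _ (hmem v), h2 _ D.x₁_mem]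
    simp

/-- The map `ςhat : V → V`, equal to `v ↦ αhat (g₁⁻¹ • v)` on `V₁` and to
`v ↦ αhat (g₂ • v)` on `V₂`. -/
def ςhat : V →ₗ[k] V := D.existsUnique_ςhat.choose

theorem ςhat_spec : (∀ v ∈ D.V₁, D.ςhat v = D.αhat (D.ρ D.g₁⁻¹ v)) ∧
    (∀ v ∈ D.V₂, D.ςhat v = D.αhat (D.ρ D.g₂ v)) :=
  D.existsUnique_ςhat.choose_spec.1

/-- The map `ς : A → A`, `v₁ ⋯ vₘ w_g ↦ ςhat(v₁) ⋯ ςhat(vₘ) χς(g) w_g`. -/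
def ς : D.A →ₗ[k] D.A := CrossedProduct.diag D.ρ D.f D.ςhat D.χς

/-- The linear map `V → A` with kernel `V₁` and `x₁ ↦ P₁ w_{g₁}`. -/
def δhat₁ : V →ₗ[k] D.A := D.coord₁.smulRight (D.ofS D.P₁ * D.w D.g₁)

/-- The linear map `V → A` with kernel `V₂` and `x₂ ↦ P₂ w_{g₂}`. -/
def δhat₂ : V →ₗ[k] D.A := D.coord₂.smulRight (D.ofS D.P₂ * D.w D.g₂)

theorem ofS_mul_w_ne_zero {P : SymmetricAlgebra k V} (hP : P ≠ 0) (g : G) :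
    D.ofS P * D.w g ≠ 0 := by
  rw [CrossedProduct.ofS_mul_w]
  intro h
  exact hP (Finsupp.single_eq_zero.1 h)

theorem δhat₁_spec : LinearMap.ker D.δhat₁ = D.V₁ ∧ D.δhat₁ D.x₁ = D.ofS D.P₁ * D.w D.g₁ := by
  constructor
  · ext v
    rw [LinearMap.mem_ker, δhat₁, LinearMap.smulRight_apply, smul_eq_zero,
      or_iff_left (D.ofS_mul_w_ne_zero D.P₁_ne_zero _), coord₁_eq_zero]
  · rw [δhat₁, LinearMap.smulRight_apply, D.coord₁_spec.2, one_smul]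

theorem δhat₂_spec : LinearMap.ker D.δhat₂ = D.V₂ ∧ D.δhat₂ D.x₂ = D.ofS D.P₂ * D.w D.g₂ := by
  constructor
  · ext v
    rw [LinearMap.mem_ker, δhat₂, LinearMap.smulRight_apply, smul_eq_zero,
      or_iff_left (D.ofS_mul_w_ne_zero D.P₂_ne_zero _), coord₂_eq_zero]
  · rw [δhat₂, LinearMap.smulRight_apply, D.coord₂_spec.2, one_smul]

theorem vprod_eq (vs : List V) :
    D.vprod vs = D.ofS (vs.map (SymmetricAlgebra.ι k V)).prod :=
  CrossedProduct.vprod_eq D.ρ D.f vs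

theorem α_vprod (vs : List V) : D.α (D.vprod vs) = D.vprod (vs.map D.αhat) := by
  rw [vprod_eq, vprod_eq, α, CrossedProduct.ofS_apply,
    CrossedProduct.auto_sing, map_one, Units.val_one, one_smul, map_list_prod, List.map_map,
    List.map_map, CrossedProduct.ofS_apply]
  congr 3
  funext v
  simp

theorem α_symm_vprod (vs : List V) : D.α.symm (D.vprod vs) = D.vprod (vs.map D.αhat.symm) := by
  rw [AlgEquiv.symm_apply_eq, α_vprod, List.map_map]
  have : (D.αhat ∘ D.αhat.symm : V → V) = id := by funext v; simp
  rw [this, List.map_id]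

theorem ς_vprod_w (vs : List V) (g : G) :
    D.ς (D.vprod vs * D.w g) = D.vprod (vs.map D.ςhat) * ((D.χς g : k) • D.w g) := by
  rw [vprod_eq, vprod_eq, CrossedProduct.ofS_mul_w, ς,
    CrossedProduct.diag_sing, mul_smul_comm, CrossedProduct.ofS_mul_w, map_list_prod,
    List.map_map, List.map_map]
  congr 4
  funext v
  simp

theorem ς_vprod (vs : List V) : D.ς (D.vprod vs) = D.vprod (vs.map D.ςhat) := by
  have h := D.ς_vprod_w vs 1
  have h1 : D.w 1 = 1 := rfl
  simpa [h1] using h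

/-- Well-definedness of `δ₁`. -/
theorem existsUnique_δ₁ : ∃! δ : D.A →ₗ[k] D.A, ∀ (vs : List V) (g : G),
    δ (D.vprod vs * D.w g) = ∑ j : Fin vs.length,
      D.α (D.vprod (vs.take j)) * D.δhat₁ (vs.get j) *
        D.ς (D.vprod (vs.drop (j + 1)) * D.w g) := by
  simp only [α_vprod, ς_vprod_w]
  refine CrossedProduct.existsUnique_skew D.ρ D.f D.αhat.toLinearMap D.ςhat D.δhat₁
    (fun g => (D.χς g : k) • D.w g) fun v u => ?_
  let E : V →ₗ[k] V := D.ρ D.g₁ ∘ₗ D.ςhat - D.αhat.toLinearMap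
  have hE : ∀ v, E v = D.coord₁ v • E D.x₁ := by
    intro v
    have h1 : ∀ v ∈ D.V₁, E v = 0 := by
      intro v hv
      simp only [E, LinearMap.sub_apply, LinearMap.comp_apply, D.ςhat_spec.1 v hv,
        ← D.αhat_equivariant, LinearEquiv.coe_coe]
      rw [← Module.End.mul_apply, ← map_mul, mul_inv_cancel, map_one, Module.End.one_apply,
        sub_self]
    have h2 := h1 _ (D.coord₁_eq_iff.1 (rfl : D.coord₁ v = D.coord₁ v))
    rwa [map_sub, map_smul, sub_eq_zero] at h2
  have hkey : D.coord₁ v • E u = D.coord₁ u • E v := by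
    rw [hE u, hE v, smul_smul, smul_smul, mul_comm]
  have hδ : ∀ y z : V, D.δhat₁ y * D.ofV (D.ςhat z)
      = D.coord₁ y • (D.ofS (D.P₁ * SymmetricAlgebra.ι k V (D.ρ D.g₁ (D.ςhat z))) * D.w D.g₁) := by
    intro y z
    rw [δhat₁, LinearMap.smulRight_apply, smul_mul_assoc, mul_assoc, CrossedProduct.ofV_apply,
      CrossedProduct.w_mul_ofS, symMap_ι, ← mul_assoc, map_mul]
  have hδ' : ∀ y z : V, D.ofV (D.αhat.toLinearMap y) * D.δhat₁ z
      = D.coord₁ z • (D.ofS (D.P₁ * SymmetricAlgebra.ι k V (D.αhat y)) * D.w D.g₁) := by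
    intro y z
    rw [δhat₁, LinearMap.smulRight_apply, mul_smul_comm, ← mul_assoc, CrossedProduct.ofV_apply,
      ← map_mul, mul_comm D.P₁]
    rfl
  have hE' : ∀ z, D.ρ D.g₁ (D.ςhat z) = E z + D.αhat z := by intro z; simp [E]
  have h3 := congrArg (fun t => D.ofS (D.P₁ * SymmetricAlgebra.ι k V t) * D.w D.g₁) hkey
  simp only [map_smul, mul_smul_comm, smul_mul_assoc] at h3
  rw [hδ, hδ, hδ', hδ', hE', hE']
  simp only [map_add, mul_add, add_mul, smul_add, h3]
  abel

/-- The map `δ₁ : A → A`,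
`δ₁(v₁ ⋯ vₘ w_g) = ∑ⱼ α(v₁ ⋯ vⱼ₋₁) δhat₁(vⱼ) ς(vⱼ₊₁ ⋯ vₘ w_g)`. -/
def δ₁ : Module.End k D.A := D.existsUnique_δ₁.choose

theorem δ₁_spec (vs : List V) (g : G) :
    D.δ₁ (D.vprod vs * D.w g) = ∑ j : Fin vs.length,
      D.α (D.vprod (vs.take j)) * D.δhat₁ (vs.get j) *
        D.ς (D.vprod (vs.drop (j + 1)) * D.w g) :=
  D.existsUnique_δ₁.choose_spec.1 vs g

/-- Well-definedness of `δ₂`. -/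
theorem existsUnique_δ₂ : ∃! δ : D.A →ₗ[k] D.A, ∀ (vs : List V) (g : G),
    δ (D.vprod vs * D.w g) = ∑ j : Fin vs.length,
      D.ς (D.α.symm (D.vprod (vs.take j))) * D.δhat₂ (vs.get j) *
        (D.vprod (vs.drop (j + 1)) * D.w g) := by
  have h0 := CrossedProduct.existsUnique_skew D.ρ D.f (D.ςhat ∘ₗ D.αhat.symm.toLinearMap)
    LinearMap.id D.δhat₂ (fun g => D.w g) fun v u => ?_
  · simpa only [α_symm_vprod, ς_vprod, List.map_map, LinearMap.id_coe, List.map_id,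
      LinearMap.coe_comp, LinearEquiv.coe_coe] using h0
  let E : V →ₗ[k] V := D.ρ D.g₂ - D.ςhat ∘ₗ D.αhat.symm.toLinearMap
  have hst : ∀ v ∈ D.V₂, D.αhat.symm v ∈ D.V₂ := by
    intro v hv
    have h1 := D.coord₂_eq_iff.1 (rfl : D.coord₂ (D.αhat.symm v) = D.coord₂ (D.αhat.symm v))
    have h2 := D.αhat_stable₂ _ h1
    rw [map_sub, map_smul, LinearEquiv.apply_symm_apply] at h2
    have h3 : D.coord₂ (D.αhat.symm v) • D.αhat D.x₂ ∈ D.V₂ := by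
      have := D.V₂.sub_mem hv h2
      rwa [sub_sub_cancel] at this
    rw [← D.coord₂_eq_zero]
    by_contra hne
    have h4 : D.αhat D.x₂ ∈ D.V₂ := (D.V₂.smul_mem_iff hne).1 h3
    -- then `αhat` would map `V` into `V₂`
    have h5 : ∀ u, D.αhat u ∈ D.V₂ := by
      intro u
      have h6 := D.αhat_stable₂ _ (D.coord₂_eq_iff.1 (rfl : D.coord₂ u = D.coord₂ u))
      rw [map_sub, map_smul] at h6
      have := D.V₂.add_mem h6 (D.V₂.smul_mem (D.coord₂ u) h4)
      rwa [sub_add_cancel] at this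
    have h7 := h5 (D.αhat.symm D.x₂)
    rw [LinearEquiv.apply_symm_apply] at h7
    exact D.x₂_notMem h7
  have hE : ∀ v, E v = D.coord₂ v • E D.x₂ := by
    intro v
    have h1 : ∀ v ∈ D.V₂, E v = 0 := by
      intro v hv
      simp only [E, LinearMap.sub_apply, LinearMap.comp_apply, LinearEquiv.coe_coe,
        D.ςhat_spec.2 _ (hst v hv), D.αhat_equivariant, LinearEquiv.apply_symm_apply, sub_self]
    have h2 := h1 _ (D.coord₂_eq_iff.1 (rfl : D.coord₂ v = D.coord₂ v))
    rwa [map_sub, map_smul, sub_eq_zero] at h2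
  have hkey : D.coord₂ v • E u = D.coord₂ u • E v := by
    rw [hE u, hE v, smul_smul, smul_smul, mul_comm]
  have hδ : ∀ y z : V, D.δhat₂ y * D.ofV z
      = D.coord₂ y • (D.ofS (D.P₂ * SymmetricAlgebra.ι k V (D.ρ D.g₂ z)) * D.w D.g₂) := by
    intro y z
    rw [δhat₂, LinearMap.smulRight_apply, smul_mul_assoc, mul_assoc, CrossedProduct.ofV_apply,
      CrossedProduct.w_mul_ofS, symMap_ι, ← mul_assoc, map_mul]
  have hδ' : ∀ y z : V, D.ofV y * D.δhat₂ z
      = D.coord₂ z • (D.ofS (D.P₂ * SymmetricAlgebra.ι k V y) * D.w D.g₂) := by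
    intro y z
    rw [δhat₂, LinearMap.smulRight_apply, mul_smul_comm, ← mul_assoc, CrossedProduct.ofV_apply,
      ← map_mul, mul_comm D.P₂]
  have hE' : ∀ z, D.ρ D.g₂ z = E z + (D.ςhat ∘ₗ D.αhat.symm.toLinearMap) z := by
    intro z; simp [E]
  have h3 := congrArg (fun t => D.ofS (D.P₂ * SymmetricAlgebra.ι k V t) * D.w D.g₂) hkey
  simp only [map_smul, mul_smul_comm, smul_mul_assoc] at h3
  rw [LinearMap.id_apply, LinearMap.id_apply, hδ, hδ, hδ', hδ', hE', hE']
  simp only [map_add, mul_add, add_mul, smul_add, h3]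
  abel

/-- The map `δ₂ : A → A`,
`δ₂(v₁ ⋯ vₘ w_g) = ∑ⱼ ς(α⁻¹(v₁ ⋯ vⱼ₋₁)) δhat₂(vⱼ) vⱼ₊₁ ⋯ vₘ w_g`. -/
def δ₂ : Module.End k D.A := D.existsUnique_δ₂.choose

theorem δ₂_spec (vs : List V) (g : G) :
    D.δ₂ (D.vprod vs * D.w g) = ∑ j : Fin vs.length,
      D.ς (D.α.symm (D.vprod (vs.take j))) * D.δhat₂ (vs.get j) *
        (D.vprod (vs.drop (j + 1)) * D.w g) :=
  D.existsUnique_δ₂.choose_spec.1 vs g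

end FirstCase

end

/-! For the good transposition attached to `α`, moving a homogeneous element of degree `n` past `a`
turns `a` into `αⁿ(a)`, where `σ`, `D₁`, `D₂` have degrees `0`, `1`, `-1`. A module algebra
structure on `(A, s)` is therefore the same as three operators on `A` that commute with `α` and
satisfy the relations of `H_q`, where `σ` acts by an algebra automorphism, `D₁` by an `(α, σ)`-skew
derivation and `D₂` by a `(σα⁻¹, id)`-skew derivation (`isModuleAlgebra_actOf`, `exists_act_iff`).
As `V` and the `w_g` generate `A`, the prescribed values force these operators to be `ς`, `δ₁`, `δ₂`
(`act_generators_iff`). It remains to decide when these three maps have the required properties.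

Skew derivations with common twists agree as soon as they agree on `V` and the `w_g`
(`skewDerivation_ext`), so each property becomes an identity on generators. Both sides vanish on the
`w_g`, and on `V` only the value at `xᵢ` carries information. The Leibniz rule for `δᵢ` reduces to
the two ways of computing `δᵢ(w_g v) = δᵢ((gv) w_g)`; this gives conditions 2 and 3. Commutation
with `α` at `xᵢ` gives condition 4. For the relation `δᵢς = qςδᵢ`, note that `Pᵢ ∈ S(Vᵢ)`, where `ς`
is `αg₁⁻¹` for `i = 1` and `αg₂` for `i = 2`. By conditions 2 to 4, `Pᵢ w_{gᵢ}` is then an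
eigenvector of `ς`, and comparing its eigenvalue with the scalar of `ςhat` on the line `V/Vᵢ` gives
condition 1. Finally, `δ₁δ₂ - δ₂δ₁` is a `(ς, ς)`-skew derivation whose values at `x₁`, `x₂` are
governed by `δ₂(P₁)` and `δ₁(P₂)`; this gives condition 5. Condition 6 is the nilpotency relation
itself. -/

theorem smul_eq_smul_iff_of_mul_eq {k M : Type*} [Field k] [AddCommGroup M] [Module k M]
    {c d e : k} (hc : c ≠ 0) (h : c * e = d) {x y : M} : c • x = d • y ↔ x = e • y := by
  rw [← h, mul_smul]
  exact (smul_right_injective M hc).eq_iff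

/-! ### Generators of the crossed product. -/

namespace CrossedProduct

variable {k G V : Type*} [Field k] [Group G] [AddCommGroup V] [Module k V]
  {ρ : Representation k G V} {f : NormalCocycle G k}

theorem w_mul_w (g h : G) : w ρ f g * w ρ f h = (f g h : k) • w ρ f (g * h) := by
  simp [w, sing_mul_sing]

theorem w_one : w ρ f 1 = 1 := rfl

theorem w_mul_ofV (g : G) (v : V) : w ρ f g * ofV ρ f v = ofV ρ f (ρ g v) * w ρ f g := by
  rw [ofV_apply, w_mul_ofS, symMap_ι, ofV_apply]

theorem vprod_cons (v : V) (vs : List V) :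
    vprod ρ f (v :: vs) = ofV ρ f v * vprod ρ f vs := by
  simp [vprod]

theorem vprod_nil : vprod ρ f [] = 1 := by simp [vprod]

/-- Up to the nonzero scalar `f(g, g⁻¹)`, the element `w_{g⁻¹}` is a right inverse of `w_g`. -/
theorem eq_zero_of_mul_w {x : CrossedProduct ρ f} {g : G} (h : x * w ρ f g = 0) : x = 0 := by
  have h1 : x * w ρ f g * w ρ f g⁻¹ = 0 := by rw [h, zero_mul]
  rw [mul_assoc, w_mul_w, mul_inv_cancel, w_one, mul_smul_comm, mul_one] at h1
  exact (smul_eq_zero.1 h1).resolve_left (Units.ne_zero _)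

/-- Linear maps out of the crossed product agree once they agree on the `w_g` and agreement
propagates under left multiplication by vectors. -/
theorem linearMap_ext_left {M : Type*} [AddCommGroup M] [Module k M]
    {F F' : CrossedProduct ρ f →ₗ[k] M} (hw : ∀ g, F (w ρ f g) = F' (w ρ f g))
    (hV : ∀ v x, F x = F' x → F (ofV ρ f v * x) = F' (ofV ρ f v * x)) : F = F' := by
  refine LinearMap.ext_on (span_vprod ρ f) ?_
  rintro _ ⟨vs, g, rfl⟩
  induction vs with
  | nil => simpa [vprod_nil] using hw g
  | cons v vs ih =>
    rw [vprod_cons, mul_assoc]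
    exact hV _ _ ih

/-- The crossed product is generated by `V` and the `w_g`. -/
theorem generators_induction {p : CrossedProduct ρ f → Prop} (hV : ∀ v, p (ofV ρ f v))
    (hw : ∀ g, p (w ρ f g)) (hadd : ∀ x y, p x → p y → p (x + y))
    (hsmul : ∀ (c : k) x, p x → p (c • x)) (hmul : ∀ x y, p x → p y → p (x * y))
    (x : CrossedProduct ρ f) : p x := by
  have hx : x ∈ Submodule.span k
      {x : CrossedProduct ρ f | ∃ vs g, x = vprod ρ f vs * w ρ f g} := by
    rw [span_vprod]; trivial
  induction hx using Submodule.span_induction with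
  | mem x hx =>
    obtain ⟨vs, g, rfl⟩ := hx
    induction vs with
    | nil => simpa [vprod_nil] using hw g
    | cons v vs ih =>
      rw [vprod_cons, mul_assoc]
      exact hmul _ _ (hV v) ih
  | zero => simpa using hsmul 0 _ (hw 1)
  | add x y _ _ hx hy => exact hadd x y hx hy
  | smul c x _ hx => exact hsmul c x hx

end CrossedProduct

/-! ### Skew derivations. -/

section skew

variable {k A : Type*} [Field k] [Ring A] [Algebra k A]

/-- `δ` is an `(a, c)`-skew derivation: `δ(xy) = δ(x) c(y) + a(x) δ(y)`. -/
def IsSkewDerivation (a c δ : A →ₗ[k] A) : Prop :=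
  ∀ x y, δ (x * y) = δ x * c y + a x * δ y

end skew

namespace CrossedProduct

variable {k G V : Type*} [Field k] [Group G] [AddCommGroup V] [Module k V]
  {ρ : Representation k G V} {f : NormalCocycle G k}

/-- The Leibniz rule determines the value at `vx` from the values at `v` and `x`. The twists need
not be multiplicative, so the lemma also applies to composites, commutators and the zero map. -/
theorem skewDerivation_ext {a c δ δ' : CrossedProduct ρ f →ₗ[k] CrossedProduct ρ f}
    (h : IsSkewDerivation a c δ) (h' : IsSkewDerivation a c δ')
    (hV : ∀ v, δ (ofV ρ f v) = δ' (ofV ρ f v)) (hw : ∀ g, δ (w ρ f g) = δ' (w ρ f g)) :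
    δ = δ' :=
  linearMap_ext_left hw fun v x hx => by rw [h, h', hV, hx]

/-- The elements `x` for which the rule holds against every `y` are closed under products, because
`a` and `c` are multiplicative; so only `x = v` and `x = w_g` matter. The first case is `hV`. The
second rests on `h`, the consistency condition imposed by `w_g v = (gv) w_g`. -/
theorem isSkewDerivation_of_left (a c : CrossedProduct ρ f →ₐ[k] CrossedProduct ρ f)
    (δ : CrossedProduct ρ f →ₗ[k] CrossedProduct ρ f) (hw : ∀ g, δ (w ρ f g) = 0)
    (hV : ∀ v x, δ (ofV ρ f v * x) = δ (ofV ρ f v) * c x + a (ofV ρ f v) * δ x)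
    (h : ∀ g v, a (w ρ f g) * δ (ofV ρ f v) = δ (ofV ρ f (ρ g v)) * c (w ρ f g)) :
    IsSkewDerivation a.toLinearMap c.toLinearMap δ := by
  intro x
  simp only [AlgHom.toLinearMap_apply]
  refine generators_induction
    (p := fun x => ∀ y, δ (x * y) = δ x * c y + a x * δ y) hV ?_ ?_ ?_ ?_ x
  · intro g y
    rw [hw, zero_mul, zero_add]
    -- Since `δ(w_g) = 0`, the rule for `x = w_g` says that `δ` carries left multiplication by `w_g`
    -- to left multiplication by `a(w_g)`.
    have key : δ ∘ₗ LinearMap.mulLeft k (w ρ f g)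
        = LinearMap.mulLeft k (a (w ρ f g)) ∘ₗ δ := by
      refine linearMap_ext_left (fun g' => ?_) fun v x hx => ?_
      · simp [w_mul_w, hw]
      · simp only [LinearMap.comp_apply, LinearMap.mulLeft_apply] at hx ⊢
        -- Expand `δ((gv) w_g x)` by `hV` and use the induction hypothesis for `δ(w_g x)`. Then `h`
        -- matches the terms containing `δ(v)`, and `a(gv) a(w_g) = a(w_g) a(v)` matches the others.
        rw [← mul_assoc, w_mul_ofV, mul_assoc, hV, hx, hV, map_mul, mul_add, ← mul_assoc,
          ← mul_assoc, ← mul_assoc, h, ← map_mul, ← w_mul_ofV, map_mul, mul_assoc (a _)]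
    exact LinearMap.congr_fun key y
  · intro x x' hx hx' y
    rw [add_mul, map_add, hx, hx', map_add, map_add]
    noncomm_ring
  · intro r x hx y
    rw [smul_mul_assoc, map_smul, hx, map_smul, map_smul, smul_mul_assoc, smul_mul_assoc, smul_add]
  · intro x x' hx hx' y
    rw [mul_assoc, hx, hx', hx, map_mul, map_mul]
    noncomm_ring

end CrossedProduct

/-! ### Scalars on the lines `V/Vᵢ` and the automorphism `ς`. -/

namespace FirstCase

variable {k G V : Type*} [Field k] [Group G] [AddCommGroup V] [Module k V] (D : FirstCase k G V)

theorem linear_eq_of_V₁ {M : Type*} [AddCommGroup M] [Module k M] {F F' : V →ₗ[k] M}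
    (h₁ : ∀ v ∈ D.V₁, F v = F' v) (hx : F D.x₁ = F' D.x₁) : F = F' := by
  ext v
  have h := h₁ _ (D.coord₁_eq_iff.1 (rfl : D.coord₁ v = D.coord₁ v))
  simpa [hx] using h

theorem linear_eq_of_V₂ {M : Type*} [AddCommGroup M] [Module k M] {F F' : V →ₗ[k] M}
    (h₂ : ∀ v ∈ D.V₂, F v = F' v) (hx : F D.x₂ = F' D.x₂) : F = F' := by
  ext v
  have h := h₂ _ (D.coord₂_eq_iff.1 (rfl : D.coord₂ v = D.coord₂ v))
  simpa [hx] using h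

/-- A map preserving `V₁` acts on the line `V/V₁` by a scalar, which can be read off at `x₁`. -/
theorem coord₁_comp {φ : V →ₗ[k] V} (hφ : ∀ v ∈ D.V₁, φ v ∈ D.V₁) (v : V) :
    D.coord₁ (φ v) = D.coord₁ (φ D.x₁) * D.coord₁ v := by
  have h : D.coord₁ ∘ₗ φ = D.coord₁ (φ D.x₁) • D.coord₁ := by
    refine D.linear_eq_of_V₁ (fun v hv => ?_) ?_
    · simp [D.coord₁_eq_zero.2 (hφ v hv), D.coord₁_eq_zero.2 hv]
    · simp [D.coord₁_spec.2]
  exact LinearMap.congr_fun h v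

theorem coord₂_comp {φ : V →ₗ[k] V} (hφ : ∀ v ∈ D.V₂, φ v ∈ D.V₂) (v : V) :
    D.coord₂ (φ v) = D.coord₂ (φ D.x₂) * D.coord₂ v := by
  have h : D.coord₂ ∘ₗ φ = D.coord₂ (φ D.x₂) • D.coord₂ := by
    refine D.linear_eq_of_V₂ (fun v hv => ?_) ?_
    · simp [D.coord₂_eq_zero.2 (hφ v hv), D.coord₂_eq_zero.2 hv]
    · simp [D.coord₂_spec.2]
  exact LinearMap.congr_fun h v

theorem coord₁_ρ (g : G) (v : V) : D.coord₁ (D.ρ g v) = D.lam₁ g * D.coord₁ v :=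
  D.coord₁_comp (D.G_stable₁ g) v

theorem coord₂_ρ (g : G) (v : V) : D.coord₂ (D.ρ g v) = D.lam₂ g * D.coord₂ v :=
  D.coord₂_comp (D.G_stable₂ g) v

theorem coord₁_αhat (v : V) : D.coord₁ (D.αhat v) = D.ν₁ * D.coord₁ v :=
  D.coord₁_comp (φ := D.αhat.toLinearMap) D.αhat_stable₁ v

theorem coord₂_αhat (v : V) : D.coord₂ (D.αhat v) = D.ν₂ * D.coord₂ v :=
  D.coord₂_comp (φ := D.αhat.toLinearMap) D.αhat_stable₂ v

theorem ν₁_ne_zero : D.ν₁ ≠ 0 := by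
  intro h
  have h1 := D.coord₁_αhat (D.αhat.symm D.x₁)
  simp [h, D.coord₁_spec.2] at h1

theorem ν₂_ne_zero : D.ν₂ ≠ 0 := by
  intro h
  have h1 := D.coord₂_αhat (D.αhat.symm D.x₂)
  simp [h, D.coord₂_spec.2] at h1

theorem ρ_inv_apply (g : G) (v : V) : D.ρ g (D.ρ g⁻¹ v) = v := by
  rw [← Module.End.mul_apply, ← map_mul, mul_inv_cancel, map_one, Module.End.one_apply]

theorem ρ_inv_apply' (g : G) (v : V) : D.ρ g⁻¹ (D.ρ g v) = v := by
  rw [← Module.End.mul_apply, ← map_mul, inv_mul_cancel, map_one, Module.End.one_apply]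

theorem lam₁_mul_inv (g : G) : D.lam₁ g * D.lam₁ g⁻¹ = 1 := by
  have h := D.coord₁_ρ g (D.ρ g⁻¹ D.x₁)
  rw [ρ_inv_apply, D.coord₁_spec.2] at h
  exact h.symm

theorem lam₂_mul_inv (g : G) : D.lam₂ g * D.lam₂ g⁻¹ = 1 := by
  have h := D.coord₂_ρ g (D.ρ g⁻¹ D.x₂)
  rw [ρ_inv_apply, D.coord₂_spec.2] at h
  exact h.symm

theorem lam₁_ne_zero (g : G) : D.lam₁ g ≠ 0 := left_ne_zero_of_mul_eq_one (D.lam₁_mul_inv g)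

theorem lam₂_ne_zero (g : G) : D.lam₂ g ≠ 0 := left_ne_zero_of_mul_eq_one (D.lam₂_mul_inv g)

theorem ρ_comm_of_center {z : G} (hz : z ∈ Subgroup.center G) (g : G) (v : V) :
    D.ρ z (D.ρ g v) = D.ρ g (D.ρ z v) := by
  rw [← Module.End.mul_apply, ← Module.End.mul_apply, ← map_mul, ← map_mul,
    Subgroup.mem_center_iff.1 hz g]

/-- It is enough to compare on `V₁`, where `ςhat` is `αhat ∘ g₁⁻¹`, and at `x₁ ∈ V₂`, where it is
`αhat ∘ g₂`. The cases needed are the action of `G`, through the centrality of `g₁` and `g₂`, and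
`αhat` itself. -/
theorem ςhat_comm {φ : V →ₗ[k] V} (h₁ : ∀ v ∈ D.V₁, φ v ∈ D.V₁) (h₂ : ∀ v ∈ D.V₂, φ v ∈ D.V₂)
    (hα : ∀ v, φ (D.αhat v) = D.αhat (φ v)) (hg₁ : ∀ v, φ (D.ρ D.g₁⁻¹ v) = D.ρ D.g₁⁻¹ (φ v))
    (hg₂ : ∀ v, φ (D.ρ D.g₂ v) = D.ρ D.g₂ (φ v)) (v : V) :
    D.ςhat (φ v) = φ (D.ςhat v) := by
  have h : D.ςhat ∘ₗ φ = φ ∘ₗ D.ςhat := by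
    refine D.linear_eq_of_V₁ (fun v hv => ?_) ?_
    · simp only [LinearMap.comp_apply]
      rw [D.ςhat_spec.1 _ hv, D.ςhat_spec.1 _ (h₁ v hv), hα, hg₁]
    · simp only [LinearMap.comp_apply]
      rw [D.ςhat_spec.2 _ D.x₁_mem, D.ςhat_spec.2 _ (h₂ _ D.x₁_mem), hα, hg₂]
  exact LinearMap.congr_fun h v

theorem ςhat_equivariant (g : G) (v : V) : D.ςhat (D.ρ g v) = D.ρ g (D.ςhat v) :=
  D.ςhat_comm (D.G_stable₁ g) (D.G_stable₂ g) (fun v => (D.αhat_equivariant g v).symm)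
    (fun v => (D.ρ_comm_of_center (inv_mem D.g₁_central) g v).symm)
    (fun v => (D.ρ_comm_of_center D.g₂_central g v).symm) v

theorem ςhat_αhat (v : V) : D.ςhat (D.αhat v) = D.αhat (D.ςhat v) :=
  D.ςhat_comm (φ := D.αhat.toLinearMap) D.αhat_stable₁ D.αhat_stable₂ (fun _ => rfl)
    (D.αhat_equivariant _) (D.αhat_equivariant _) v

/-- The representative `x₁` of `V/V₁` lies in `V₂`, so the scalar of `ςhat` on this line involves
`g₂`. On `V/V₂` the representative `x₂ ∈ V₁` brings in `g₁⁻¹` instead. This asymmetry is the origin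
of `q` versus `q⁻¹` in condition 1. -/
theorem coord₁_ςhat (v : V) : D.coord₁ (D.ςhat v) = D.ν₁ * D.lam₁ D.g₂ * D.coord₁ v := by
  have h : D.coord₁ (D.ςhat D.x₁) = D.ν₁ * D.lam₁ D.g₂ := by
    rw [D.ςhat_spec.2 _ D.x₁_mem, coord₁_αhat, coord₁_ρ, D.coord₁_spec.2, mul_one]
  rw [D.coord₁_comp (φ := D.ςhat) _ v, h]
  intro v hv
  rw [D.ςhat_spec.1 v hv]
  exact D.αhat_stable₁ _ (D.G_stable₁ _ _ hv)

theorem coord₂_ςhat (v : V) : D.coord₂ (D.ςhat v) = D.ν₂ * D.lam₂ D.g₁⁻¹ * D.coord₂ v := by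
  have h : D.coord₂ (D.ςhat D.x₂) = D.ν₂ * D.lam₂ D.g₁⁻¹ := by
    rw [D.ςhat_spec.1 _ D.x₂_mem, coord₂_αhat, coord₂_ρ, D.coord₂_spec.2, mul_one]
  rw [D.coord₂_comp (φ := D.ςhat) _ v, h]
  intro v hv
  rw [D.ςhat_spec.2 v hv]
  exact D.αhat_stable₂ _ (D.G_stable₂ _ _ hv)

/-- The scalar on `V/V₁` is nonzero, so the kernel lies in `V₁`, where `ςhat` is the injective map
`αhat ∘ g₁⁻¹`. In finite dimension this makes `ςhat` bijective, and hence `ς` an algebra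
automorphism. -/
theorem ςhat_injective : Function.Injective D.ςhat := by
  rw [injective_iff_map_eq_zero]
  intro v hv
  have h1 := D.coord₁_ςhat v
  rw [hv, map_zero, eq_comm, mul_eq_zero,
    or_iff_right (mul_ne_zero D.ν₁_ne_zero (D.lam₁_ne_zero _)), coord₁_eq_zero] at h1
  rw [D.ςhat_spec.1 v h1, LinearEquiv.map_eq_zero_iff] at hv
  rw [← D.ρ_inv_apply D.g₁ v, hv, map_zero]

theorem α_ofV (v : V) : D.α (D.ofV v) = D.ofV (D.αhat v) := by
  simpa [CrossedProduct.vprod] using D.α_vprod [v]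

theorem α_w (g : G) : D.α (D.w g) = (D.χα g : k) • D.w g := by
  change CrossedProduct.auto D.ρ D.f D.αhat _ D.χα (CrossedProduct.sing D.ρ D.f g 1) = _
  rw [CrossedProduct.auto_sing, map_one]
  rfl

theorem α_symm_w (g : G) : D.α.symm (D.w g) = (D.χα g : k)⁻¹ • D.w g := by
  rw [AlgEquiv.symm_apply_eq, map_smul, α_w, smul_smul, inv_mul_cancel₀ (Units.ne_zero _), one_smul]

theorem ς_ofV (v : V) : D.ς (D.ofV v) = D.ofV (D.ςhat v) := by
  simpa [CrossedProduct.vprod] using D.ς_vprod [v]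

theorem ς_w (g : G) : D.ς (D.w g) = (D.χς g : k) • D.w g := by
  simpa [CrossedProduct.vprod] using D.ς_vprod_w [] g

variable [FiniteDimensional k V]

/-- `ςhat` as a linear automorphism of `V`. -/
noncomputable def ςhatEquiv : V ≃ₗ[k] V := LinearEquiv.ofInjectiveEndo D.ςhat D.ςhat_injective

/-- `ς` as an algebra automorphism of `A`. -/
noncomputable def ςAut : D.A ≃ₐ[k] D.A :=
  CrossedProduct.auto D.ρ D.f D.ςhatEquiv D.ςhat_equivariant D.χς

theorem ςAut_apply (x : D.A) : D.ςAut x = D.ς x := rfl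

theorem ς_mul (x y : D.A) : D.ς (x * y) = D.ς x * D.ς y := map_mul D.ςAut x y

theorem α_ς (x : D.A) : D.α (D.ς x) = D.ς (D.α x) := by
  have h : D.α.toLinearMap ∘ₗ D.ς = D.ς ∘ₗ D.α.toLinearMap := by
    refine CrossedProduct.linearMap_ext_left (fun g => ?_) fun v x hx => ?_
    · simp only [LinearMap.comp_apply, AlgEquiv.toLinearMap_apply, ς_w, α_w, map_smul]
      rw [smul_comm]
    · simp only [LinearMap.comp_apply, AlgEquiv.toLinearMap_apply] at hx ⊢
      rw [ς_mul, map_mul, map_mul, ς_mul, hx, ς_ofV, α_ofV, α_ofV, ς_ofV, ςhat_αhat]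
  exact LinearMap.congr_fun h x

theorem α_symm_ς (x : D.A) : D.α.symm (D.ς x) = D.ς (D.α.symm x) := by
  rw [AlgEquiv.symm_apply_eq, α_ς, AlgEquiv.apply_symm_apply]

end FirstCase

/-! ### Leibniz rules for `δ₁`, `δ₂` and conditions 2 and 3. -/

namespace FirstCase

variable {k G V : Type*} [Field k] [Group G] [AddCommGroup V] [Module k V] (D : FirstCase k G V)

theorem vprod_cons (v : V) (vs : List V) : D.vprod (v :: vs) = D.ofV v * D.vprod vs :=
  CrossedProduct.vprod_cons v vs

theorem δ₁_w (g : G) : D.δ₁ (D.w g) = 0 := by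
  simpa [CrossedProduct.vprod] using D.δ₁_spec [] g

theorem δ₂_w (g : G) : D.δ₂ (D.w g) = 0 := by
  simpa [CrossedProduct.vprod] using D.δ₂_spec [] g

theorem δhat₁_apply (v : V) : D.δhat₁ v = D.coord₁ v • (D.ofS D.P₁ * D.w D.g₁) := rfl

theorem δhat₂_apply (v : V) : D.δhat₂ v = D.coord₂ v • (D.ofS D.P₂ * D.w D.g₂) := rfl

theorem ς_one : D.ς 1 = 1 := by
  simpa [CrossedProduct.vprod] using D.ς_vprod []

theorem δ₁_ofV (v : V) : D.δ₁ (D.ofV v) = D.δhat₁ v := by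
  have h := D.δ₁_spec [v] 1
  simpa [CrossedProduct.vprod, CrossedProduct.w_one, ς_one] using h

theorem δ₂_ofV (v : V) : D.δ₂ (D.ofV v) = D.δhat₂ v := by
  have h := D.δ₂_spec [v] 1
  simpa [CrossedProduct.vprod, CrossedProduct.w_one, ς_one] using h

/-- With a vector as left factor the Leibniz rule needs no condition on the data: it is built into
the defining sum. Only left factors `w_g` impose a condition. -/
theorem δ₁_ofV_mul (v : V) (x : D.A) :
    D.δ₁ (D.ofV v * x) = D.δ₁ (D.ofV v) * D.ς x + D.α (D.ofV v) * D.δ₁ x := by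
  have h : D.δ₁ ∘ₗ LinearMap.mulLeft k (D.ofV v) =
      LinearMap.mulLeft k (D.δ₁ (D.ofV v)) ∘ₗ D.ς
        + LinearMap.mulLeft k (D.α (D.ofV v)) ∘ₗ D.δ₁ := by
    refine LinearMap.ext_on (CrossedProduct.span_vprod D.ρ D.f) ?_
    rintro _ ⟨vs, g, rfl⟩
    simp only [LinearMap.comp_apply, LinearMap.add_apply, LinearMap.mulLeft_apply]
    have e : D.ofV v * (D.vprod vs * D.w g) = D.vprod (v :: vs) * D.w g := by
      rw [vprod_cons, mul_assoc]
    rw [e, δ₁_spec, δ₁_spec, δ₁_ofV]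
    simp only [List.length_cons]
    -- The term `j = 0` differentiates `v` and leaves `ς` of the rest; every later term has the left
    -- factor `α(v)`.
    rw [Fin.sum_univ_succ]
    simp [CrossedProduct.vprod, Finset.mul_sum, mul_assoc]
  exact LinearMap.congr_fun h x

theorem smul_ofS_mul_w_inj {P Q : SymmetricAlgebra k V} {g : G} :
    D.ofS P * D.w g = D.ofS Q * D.w g ↔ P = Q := by
  rw [CrossedProduct.ofS_mul_w, CrossedProduct.ofS_mul_w]
  exact ⟨fun h => Finsupp.single_injective g h, fun h => h ▸ rfl⟩

variable [FiniteDimensional k V]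

/-- As for `δ₁`, except that extracting the left factor `ς(α⁻¹(v))` from the later terms uses the
multiplicativity of `ς`, and so the finite dimension of `V`. -/
theorem δ₂_ofV_mul (v : V) (x : D.A) :
    D.δ₂ (D.ofV v * x) = D.δ₂ (D.ofV v) * x + D.ς (D.α.symm (D.ofV v)) * D.δ₂ x := by
  have h : D.δ₂ ∘ₗ LinearMap.mulLeft k (D.ofV v) =
      LinearMap.mulLeft k (D.δ₂ (D.ofV v))
        + LinearMap.mulLeft k (D.ς (D.α.symm (D.ofV v))) ∘ₗ D.δ₂ := by
    refine LinearMap.ext_on (CrossedProduct.span_vprod D.ρ D.f) ?_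
    rintro _ ⟨vs, g, rfl⟩
    simp only [LinearMap.comp_apply, LinearMap.add_apply, LinearMap.mulLeft_apply]
    have e : D.ofV v * (D.vprod vs * D.w g) = D.vprod (v :: vs) * D.w g := by
      rw [vprod_cons, mul_assoc]
    rw [e, δ₂_spec, δ₂_spec, δ₂_ofV]
    simp only [List.length_cons]
    rw [Fin.sum_univ_succ]
    simp [CrossedProduct.vprod, Finset.mul_sum, mul_assoc, ς_mul, ς_one]
  exact LinearMap.congr_fun h x

/-- The linear map `ς ∘ α⁻¹` as an algebra homomorphism. -/
noncomputable def ςαinv : D.A →ₐ[k] D.A := (D.α.symm.trans D.ςAut : D.A ≃ₐ[k] D.A)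

theorem ςαinv_apply (x : D.A) : D.ςαinv x = D.ς (D.α.symm x) := rfl

/-- Computing `δ₁` on `w_g v = (gv) w_g` in two ways gives multiples of `w_g w_{g₁}` and of `w_{g₁}
w_g`. Since `g₁` is central, both lie in `S(V) w_{g₁g}`, with the cocycle factors `f(g, g₁)` and
`f(g₁, g)`. Comparison of the coefficients at `v = x₁` is condition 2. -/
theorem isSkewDerivation_δ₁_iff :
    IsSkewDerivation D.α.toLinearMap D.ς D.δ₁ ↔
    ∀ g : G, symMap (D.ρ g) D.P₁ =
      (D.lam₁ g * (D.χα g : k)⁻¹ * (D.χς g : k) * (D.f g D.g₁ : k)⁻¹ * (D.f D.g₁ g : k)) • D.P₁ := by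
  have hf : ∀ g h, (D.f g h : k) ≠ 0 := fun g h => Units.ne_zero _
  have hα : ∀ g, (D.χα g : k) ≠ 0 := fun g => Units.ne_zero _
  have key : ∀ g, symMap (D.ρ g) D.P₁ = (D.lam₁ g * (D.χα g : k)⁻¹ * (D.χς g : k) *
        (D.f g D.g₁ : k)⁻¹ * (D.f D.g₁ g : k)) • D.P₁ ↔
      ∀ v, D.α (D.w g) * D.δ₁ (D.ofV v) = D.δ₁ (D.ofV (D.ρ g v)) * D.ς (D.w g) := by
    intro g
    have hL : ∀ v, D.α (D.w g) * D.δ₁ (D.ofV v) = D.coord₁ v •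
        (D.ofS (((D.χα g : k) * D.f g D.g₁) • symMap (D.ρ g) D.P₁) * D.w (D.g₁ * g)) := by
      intro v
      rw [δ₁_ofV, δhat₁_apply, α_w, mul_smul_comm, smul_mul_assoc, ← mul_assoc,
        CrossedProduct.w_mul_ofS, mul_assoc, CrossedProduct.w_mul_w,
        Subgroup.mem_center_iff.1 D.g₁_central g, map_smul, mul_smul_comm, smul_mul_assoc,
        smul_smul (D.χα g : k)]
    have hR : ∀ v, D.δ₁ (D.ofV (D.ρ g v)) * D.ς (D.w g) = D.coord₁ v •
        (D.ofS ((D.lam₁ g * (D.χς g : k) * D.f D.g₁ g) • D.P₁) * D.w (D.g₁ * g)) := by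
      intro v
      rw [δ₁_ofV, δhat₁_apply, coord₁_ρ, ς_w, mul_smul_comm, smul_mul_assoc, mul_assoc,
        CrossedProduct.w_mul_w, map_smul, mul_smul_comm, smul_mul_assoc]
      simp only [smul_smul]
      congr 1
      ring
    -- Division by the nonzero scalar `χα(g) f(g, g₁)` puts the comparison in the form of the
    -- statement.
    have e : (((D.χα g : k) * D.f g D.g₁) • symMap (D.ρ g) D.P₁ =
        (D.lam₁ g * (D.χς g : k) * D.f D.g₁ g) • D.P₁) ↔ symMap (D.ρ g) D.P₁ =
        (D.lam₁ g * (D.χα g : k)⁻¹ * (D.χς g : k) * (D.f g D.g₁ : k)⁻¹ * (D.f D.g₁ g : k)) • D.P₁ := by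
      refine smul_eq_smul_iff_of_mul_eq (mul_ne_zero (hα g) (hf g D.g₁)) ?_
      have := hf g D.g₁
      have := hα g
      field_simp
    rw [← e]
    constructor
    · intro h v
      rw [hL, hR, h]
    · intro h
      have h1 := h D.x₁
      rw [hL, hR, D.coord₁_spec.2, one_smul, one_smul, smul_ofS_mul_w_inj] at h1
      exact h1
  simp only [key]
  constructor
  · intro h g v
    -- The two products are the same element of `A`, and `δ₁(w_g) = 0` leaves one term on each side.
    have h1 := h (D.w g) (D.ofV v)
    have h2 := h (D.ofV (D.ρ g v)) (D.w g)
    rw [CrossedProduct.w_mul_ofV, h2] at h1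
    simpa [δ₁_w] using h1.symm
  · intro h
    exact CrossedProduct.isSkewDerivation_of_left (D.α : D.A →ₐ[k] D.A) (D.ςAut : D.A →ₐ[k] D.A)
      D.δ₁ D.δ₁_w D.δ₁_ofV_mul h

/-- The argument for `δ₁` with the twists `ςα⁻¹` and `id`. The character factor `χα⁻¹χς` now stands
on the side of `ᵍP₂`, and solving for `ᵍP₂` inverts it. -/
theorem isSkewDerivation_δ₂_iff :
    IsSkewDerivation D.ςαinv.toLinearMap LinearMap.id D.δ₂ ↔
    ∀ g : G, symMap (D.ρ g) D.P₂ =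
      (D.lam₂ g * (D.χα g : k) * (D.χς g : k)⁻¹ * (D.f g D.g₂ : k)⁻¹ * (D.f D.g₂ g : k)) • D.P₂ := by
  have hf : ∀ g h, (D.f g h : k) ≠ 0 := fun g h => Units.ne_zero _
  have hα : ∀ g, (D.χα g : k) ≠ 0 := fun g => Units.ne_zero _
  have hς : ∀ g, (D.χς g : k) ≠ 0 := fun g => Units.ne_zero _
  have key : ∀ g, symMap (D.ρ g) D.P₂ = (D.lam₂ g * (D.χα g : k) * (D.χς g : k)⁻¹ *
        (D.f g D.g₂ : k)⁻¹ * (D.f D.g₂ g : k)) • D.P₂ ↔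
      ∀ v, D.ςαinv (D.w g) * D.δ₂ (D.ofV v) = D.δ₂ (D.ofV (D.ρ g v)) * D.w g := by
    intro g
    have hL : ∀ v, D.ςαinv (D.w g) * D.δ₂ (D.ofV v) = D.coord₂ v •
        (D.ofS (((D.χα g : k)⁻¹ * (D.χς g : k) * D.f g D.g₂) • symMap (D.ρ g) D.P₂)
          * D.w (D.g₂ * g)) := by
      intro v
      rw [δ₂_ofV, δhat₂_apply, ςαinv_apply, α_symm_w, map_smul, ς_w, mul_smul_comm,
        smul_mul_assoc, smul_mul_assoc, ← mul_assoc,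
        CrossedProduct.w_mul_ofS, mul_assoc, CrossedProduct.w_mul_w,
        Subgroup.mem_center_iff.1 D.g₂_central g, map_smul, mul_smul_comm, smul_mul_assoc,
        smul_smul (D.χς g : k), smul_smul (D.χα g : k)⁻¹, mul_assoc]
    have hR : ∀ v, D.δ₂ (D.ofV (D.ρ g v)) * D.w g = D.coord₂ v •
        (D.ofS ((D.lam₂ g * D.f D.g₂ g) • D.P₂) * D.w (D.g₂ * g)) := by
      intro v
      rw [δ₂_ofV, δhat₂_apply, coord₂_ρ, smul_mul_assoc, mul_assoc,
        CrossedProduct.w_mul_w, map_smul, mul_smul_comm, smul_mul_assoc]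
      simp only [smul_smul]
      congr 1
      ring
    have e : (((D.χα g : k)⁻¹ * (D.χς g : k) * D.f g D.g₂) • symMap (D.ρ g) D.P₂ =
        (D.lam₂ g * D.f D.g₂ g) • D.P₂) ↔ symMap (D.ρ g) D.P₂ =
        (D.lam₂ g * (D.χα g : k) * (D.χς g : k)⁻¹ * (D.f g D.g₂ : k)⁻¹ * (D.f D.g₂ g : k)) • D.P₂ := by
      refine smul_eq_smul_iff_of_mul_eq
        (mul_ne_zero (mul_ne_zero (inv_ne_zero (hα g)) (hς g)) (hf g D.g₂)) ?_
      have := hf g D.g₂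
      have := hα g
      have := hς g
      field_simp
    rw [← e]
    constructor
    · intro h v
      rw [hL, hR, h]
    · intro h
      have h1 := h D.x₂
      rw [hL, hR, D.coord₂_spec.2, one_smul, one_smul, smul_ofS_mul_w_inj] at h1
      exact h1
  simp only [key]
  constructor
  · intro h g v
    have h1 := h (D.w g) (D.ofV v)
    have h2 := h (D.ofV (D.ρ g v)) (D.w g)
    rw [CrossedProduct.w_mul_ofV, h2] at h1
    simpa [δ₂_w] using h1.symm
  · intro h
    exact CrossedProduct.isSkewDerivation_of_left D.ςαinv (AlgHom.id k D.A)
      D.δ₂ D.δ₂_w D.δ₂_ofV_mul h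

end FirstCase

/-! ### Commutation of `δ₁`, `δ₂` with `α`, with `ς` and with each other: conditions 1, 4 and 5. -/

/-- Since `φ` is multiplicative and commutes with both twists, `δ ∘ φ` and `r φ ∘ δ` are skew
derivations for the same twists `aφ` and `cφ`, so generators decide. It is used for `φ = α`, `r = 1`
and for `φ = ς`, `r = q`. -/
theorem IsSkewDerivation.comp_eq_smul_comp {k G V : Type*} [Field k] [Group G] [AddCommGroup V]
    [Module k V] {ρ : Representation k G V} {f : NormalCocycle G k}
    {a c δ φ : CrossedProduct ρ f →ₗ[k] CrossedProduct ρ f} (h : IsSkewDerivation a c δ)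
    (hφ : ∀ x y, φ (x * y) = φ x * φ y) (ha : ∀ x, φ (a x) = a (φ x))
    (hc : ∀ x, φ (c x) = c (φ x)) (r : k)
    (hV : ∀ v, δ (φ (CrossedProduct.ofV ρ f v)) = r • φ (δ (CrossedProduct.ofV ρ f v)))
    (hw : ∀ g, δ (φ (CrossedProduct.w ρ f g)) = r • φ (δ (CrossedProduct.w ρ f g)))
    (x : CrossedProduct ρ f) : δ (φ x) = r • φ (δ x) := by
  have e : δ ∘ₗ φ = r • φ ∘ₗ δ := by
    refine CrossedProduct.skewDerivation_ext (a := a ∘ₗ φ) (c := c ∘ₗ φ) ?_ ?_ hV hw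
    · intro x y
      simp only [LinearMap.comp_apply, hφ, h (φ x)]
    · intro x y
      simp only [LinearMap.comp_apply, LinearMap.smul_apply, h x y, map_add, hφ, ha, hc,
        smul_add, smul_mul_assoc, mul_smul_comm]
  exact LinearMap.congr_fun e x

namespace FirstCase

variable {k G V : Type*} [Field k] [Group G] [AddCommGroup V] [Module k V] (D : FirstCase k G V)

theorem δ₁_x₁ : D.δ₁ (D.ofV D.x₁) = D.ofS D.P₁ * D.w D.g₁ := by
  rw [δ₁_ofV, D.δhat₁_spec.2]

theorem δ₂_x₂ : D.δ₂ (D.ofV D.x₂) = D.ofS D.P₂ * D.w D.g₂ := by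
  rw [δ₂_ofV, D.δhat₂_spec.2]

theorem δ₁_x₂ : D.δ₁ (D.ofV D.x₂) = 0 := by
  rw [δ₁_ofV, δhat₁_apply, D.coord₁_eq_zero.2 D.x₂_mem, zero_smul]

theorem δ₂_x₁ : D.δ₂ (D.ofV D.x₁) = 0 := by
  rw [δ₂_ofV, δhat₂_apply, D.coord₂_eq_zero.2 D.x₁_mem, zero_smul]

theorem α_ofS (P : SymmetricAlgebra k V) :
    D.α (D.ofS P) = D.ofS (symMap D.αhat.toLinearMap P) := by
  rw [α, CrossedProduct.ofS_apply, CrossedProduct.auto_sing, map_one, Units.val_one, one_smul]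
  rfl

theorem ς_ofS (P : SymmetricAlgebra k V) : D.ς (D.ofS P) = D.ofS (symMap D.ςhat P) := by
  rw [ς, CrossedProduct.ofS_apply, CrossedProduct.diag_sing, map_one, Units.val_one, one_smul]
  rfl

/-- Here `Pᵢ ∈ S(Vᵢ)` enters: on such elements `ςhat` may be replaced by its explicit form on `Vᵢ`.
-/
theorem symMap_eq_of_mem_adjoin {W : Submodule k V} {φ ψ : V →ₗ[k] V} (h : ∀ v ∈ W, φ v = ψ v)
    {P : SymmetricAlgebra k V}
    (hP : P ∈ Algebra.adjoin k (SymmetricAlgebra.ι k V '' (W : Set V))) :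
    symMap φ P = symMap ψ P := by
  refine AlgHom.eqOn_adjoin_iff.2 ?_ hP
  rintro _ ⟨v, hv, rfl⟩
  rw [symMap_ι, symMap_ι, h v hv]

variable [FiniteDimensional k V]

/-- On `S(V₁)` the map `ς` is `α ∘ g₁⁻¹`, and `P₁` is an eigenvector of both factors. In condition 2
at `g = g₁` the cocycle factors cancel. The values of `χα` and `χς` cancel against condition 4 and
`ς(w_{g₁}) = χς(g₁) w_{g₁}`, leaving `ν₁ λ_{1g₁}⁻¹`. -/
theorem ς_ofS_P₁_mul_w (h : symMap (D.ρ D.g₁) D.P₁ = (D.lam₁ D.g₁ * (D.χα D.g₁ : k)⁻¹ * (D.χς D.g₁ : k) *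
      (D.f D.g₁ D.g₁ : k)⁻¹ * (D.f D.g₁ D.g₁ : k)) • D.P₁)
    (h' : D.α (D.ofS D.P₁) = (D.ν₁ * (D.χα D.g₁ : k)⁻¹) • D.ofS D.P₁) :
    D.ς (D.ofS D.P₁ * D.w D.g₁) = (D.ν₁ * (D.lam₁ D.g₁)⁻¹) • (D.ofS D.P₁ * D.w D.g₁) := by
  have hα := Units.ne_zero (D.χα D.g₁)
  have hς := Units.ne_zero (D.χς D.g₁)
  have hl := D.lam₁_ne_zero D.g₁
  have e1 : symMap (D.ρ D.g₁⁻¹) D.P₁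
      = ((D.lam₁ D.g₁)⁻¹ * (D.χα D.g₁ : k) * (D.χς D.g₁ : k)⁻¹) • D.P₁ := by
    have h1 := congrArg (symMap (D.ρ D.g₁⁻¹)) h
    have h2 : D.ρ D.g₁⁻¹ ∘ₗ D.ρ D.g₁ = LinearMap.id := LinearMap.ext (D.ρ_inv_apply' D.g₁)
    rw [symMap_comp, h2, symMap_id, map_smul, mul_assoc _ (_)⁻¹,
      inv_mul_cancel₀ (Units.ne_zero _), mul_one] at h1
    -- `h1` expresses `P₁` as a multiple of its translate by `g₁⁻¹`; after substitution on the right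
    -- the total scalar is `1`.
    conv_rhs => rw [h1, smul_smul]
    rw [show ((D.lam₁ D.g₁)⁻¹ * (D.χα D.g₁ : k) * (D.χς D.g₁ : k)⁻¹) *
      (D.lam₁ D.g₁ * (D.χα D.g₁ : k)⁻¹ * (D.χς D.g₁ : k)) = 1 by field_simp, one_smul]
  have e2 : D.ς (D.ofS D.P₁) = (D.ν₁ * (D.lam₁ D.g₁)⁻¹ * (D.χς D.g₁ : k)⁻¹) • D.ofS D.P₁ := by
    have e3 := symMap_eq_of_mem_adjoin (ψ := D.αhat.toLinearMap ∘ₗ D.ρ D.g₁⁻¹) D.ςhat_spec.1 D.P₁_mem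
    rw [ς_ofS, e3, ← symMap_comp, ← α_ofS, e1, map_smul, map_smul, h', smul_smul]
    congr 1
    field_simp
  rw [ς_mul, e2, ς_w, smul_mul_smul_comm]
  congr 1
  field_simp

/-- On `S(V₂)` the map `ς` is `α ∘ g₂`, without an inverse, so `λ_{2g₂}` itself appears. -/
theorem ς_ofS_P₂_mul_w (h : symMap (D.ρ D.g₂) D.P₂ = (D.lam₂ D.g₂ * (D.χα D.g₂ : k) *
      (D.χς D.g₂ : k)⁻¹ * (D.f D.g₂ D.g₂ : k)⁻¹ * (D.f D.g₂ D.g₂ : k)) • D.P₂)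
    (h' : D.α (D.ofS D.P₂) = (D.ν₂ * (D.χα D.g₂ : k)⁻¹) • D.ofS D.P₂) :
    D.ς (D.ofS D.P₂ * D.w D.g₂) = (D.ν₂ * D.lam₂ D.g₂) • (D.ofS D.P₂ * D.w D.g₂) := by
  have hα := Units.ne_zero (D.χα D.g₂)
  have hς := Units.ne_zero (D.χς D.g₂)
  have hf := Units.ne_zero (D.f D.g₂ D.g₂)
  have e3 := symMap_eq_of_mem_adjoin (ψ := D.αhat.toLinearMap ∘ₗ D.ρ D.g₂) D.ςhat_spec.2 D.P₂_mem
  rw [ς_mul, ς_w, ς_ofS, e3, ← symMap_comp, ← α_ofS, h, map_smul, map_smul, h', smul_smul,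
    smul_mul_smul_comm]
  congr 1
  field_simp

/-- At `x₁` the two sides are `ν₁ P₁ w_{g₁}` and `χα(g₁) α(P₁) w_{g₁}`, and `w_{g₁}` can be
cancelled. -/
theorem δ₁_α_iff (h : IsSkewDerivation D.α.toLinearMap D.ς D.δ₁) :
    (∀ x, D.δ₁ (D.α x) = D.α (D.δ₁ x)) ↔
      D.α (D.ofS D.P₁) = (D.ν₁ * (D.χα D.g₁ : k)⁻¹) • D.ofS D.P₁ := by
  have hα := Units.ne_zero (D.χα D.g₁)
  constructor
  · intro hc
    have h1 := hc (D.ofV D.x₁)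
    rw [α_ofV, δ₁_x₁, δ₁_ofV, δhat₁_apply, coord₁_αhat, D.coord₁_spec.2, mul_one, map_mul, α_w,
      mul_smul_comm, ← smul_mul_assoc, ← smul_mul_assoc, ← sub_eq_zero, ← sub_mul] at h1
    have h2 := sub_eq_zero.1 (CrossedProduct.eq_zero_of_mul_w h1)
    exact (smul_eq_smul_iff_of_mul_eq hα (by field_simp)).1 h2.symm
  · intro hP x
    have := h.comp_eq_smul_comp (φ := D.α.toLinearMap) (map_mul D.α) (fun _ => rfl) D.α_ς 1
      (fun v => ?_) (fun g => ?_) x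
    · simpa using this
    · simp only [AlgEquiv.toLinearMap_apply, one_smul]
      rw [α_ofV, δ₁_ofV, δ₁_ofV, δhat₁_apply, δhat₁_apply, coord₁_αhat, map_smul, map_mul, hP, α_w,
        smul_mul_smul_comm, smul_smul]
      congr 1
      field_simp
    · simp only [AlgEquiv.toLinearMap_apply, α_w, map_smul, δ₁_w, map_zero, smul_zero]

theorem δ₂_α_iff (h : IsSkewDerivation D.ςαinv.toLinearMap LinearMap.id D.δ₂) :
    (∀ x, D.δ₂ (D.α x) = D.α (D.δ₂ x)) ↔
      D.α (D.ofS D.P₂) = (D.ν₂ * (D.χα D.g₂ : k)⁻¹) • D.ofS D.P₂ := by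
  have hα := Units.ne_zero (D.χα D.g₂)
  constructor
  · intro hc
    have h1 := hc (D.ofV D.x₂)
    rw [α_ofV, δ₂_x₂, δ₂_ofV, δhat₂_apply, coord₂_αhat, D.coord₂_spec.2, mul_one, map_mul, α_w,
      mul_smul_comm, ← smul_mul_assoc, ← smul_mul_assoc, ← sub_eq_zero, ← sub_mul] at h1
    have h2 := sub_eq_zero.1 (CrossedProduct.eq_zero_of_mul_w h1)
    exact (smul_eq_smul_iff_of_mul_eq hα (by field_simp)).1 h2.symm
  · intro hP x
    have := h.comp_eq_smul_comp (φ := D.α.toLinearMap) (map_mul D.α) (fun x => ?_) (fun _ => rfl) 1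
      (fun v => ?_) (fun g => ?_) x
    · simpa using this
    · simp only [AlgEquiv.toLinearMap_apply, AlgHom.toLinearMap_apply, ςαinv_apply, α_ς,
        AlgEquiv.apply_symm_apply, AlgEquiv.symm_apply_apply]
    · simp only [AlgEquiv.toLinearMap_apply, one_smul]
      rw [α_ofV, δ₂_ofV, δ₂_ofV, δhat₂_apply, δhat₂_apply, coord₂_αhat, map_smul, map_mul, hP, α_w,
        smul_mul_smul_comm, smul_smul]
      congr 1
      field_simp
    · simp only [AlgEquiv.toLinearMap_apply, α_w, map_smul, δ₂_w, map_zero, smul_zero]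

/-- At `x₁` both sides are multiples of `P₁ w_{g₁} ≠ 0`, with scalars `ν₁ λ_{1g₂}` and `q ν₁
λ_{1g₁}⁻¹`. Since `ν₁ ≠ 0`, equality is the formula for `q`. -/
theorem δ₁_ς_iff (h : IsSkewDerivation D.α.toLinearMap D.ς D.δ₁)
    (hα : ∀ x, D.δ₁ (D.α x) = D.α (D.δ₁ x)) (q : kˣ) :
    (∀ x, D.δ₁ (D.ς x) = (q : k) • D.ς (D.δ₁ x)) ↔ (q : k) = D.lam₁ D.g₁ * D.lam₁ D.g₂ := by
  have hν := D.ν₁_ne_zero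
  have hl := D.lam₁_ne_zero D.g₁
  have e := D.ς_ofS_P₁_mul_w (D.isSkewDerivation_δ₁_iff.1 h D.g₁) ((D.δ₁_α_iff h).1 hα)
  have hV : ∀ v, (D.δ₁ (D.ς (D.ofV v)) = (q : k) • D.ς (D.δ₁ (D.ofV v))) ↔
      (D.coord₁ v * (D.ν₁ * D.lam₁ D.g₂)) • (D.ofS D.P₁ * D.w D.g₁)
      = (D.coord₁ v * (q * (D.ν₁ * (D.lam₁ D.g₁)⁻¹))) • (D.ofS D.P₁ * D.w D.g₁) := by
    intro v
    rw [ς_ofV, δ₁_ofV, δ₁_ofV, δhat₁_apply, δhat₁_apply, coord₁_ςhat, map_smul, e, smul_smul,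
      smul_smul, mul_comm (D.coord₁ v), mul_comm (q : k) (D.coord₁ v), mul_assoc (D.coord₁ v)]
  constructor
  · intro hc
    have h1 := smul_left_injective k (D.ofS_mul_w_ne_zero D.P₁_ne_zero D.g₁)
      ((hV D.x₁).1 (hc (D.ofV D.x₁)))
    rw [D.coord₁_spec.2] at h1
    field_simp at h1
    rw [← h1, mul_comm]
  · intro hq
    refine h.comp_eq_smul_comp D.ς_mul (fun x => (D.α_ς x).symm) (fun _ => rfl) q
      (fun v => ?_) (fun g => ?_)
    · rw [hV, hq]
      congr 1
      field_simp
    · simp only [ς_w, map_smul, δ₁_w, map_zero, smul_zero]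

/-- The scalars at `x₂` are `ν₂ λ_{2g₁}⁻¹` and `q ν₂ λ_{2g₂}`, with the inverse on the other side
than for `δ₁`; hence the formula is for `q⁻¹`. -/
theorem δ₂_ς_iff (h : IsSkewDerivation D.ςαinv.toLinearMap LinearMap.id D.δ₂)
    (hα : ∀ x, D.δ₂ (D.α x) = D.α (D.δ₂ x)) (q : kˣ) :
    (∀ x, D.δ₂ (D.ς x) = (q : k) • D.ς (D.δ₂ x)) ↔ (q : k)⁻¹ = D.lam₂ D.g₁ * D.lam₂ D.g₂ := by
  have hν := D.ν₂_ne_zero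
  have hl := D.lam₂_ne_zero D.g₁
  have hl' := D.lam₂_ne_zero D.g₂
  have hq0 := q.ne_zero
  have hinv : D.lam₂ D.g₁⁻¹ = (D.lam₂ D.g₁)⁻¹ := eq_inv_of_mul_eq_one_right (D.lam₂_mul_inv _)
  have e := D.ς_ofS_P₂_mul_w (D.isSkewDerivation_δ₂_iff.1 h D.g₂) ((D.δ₂_α_iff h).1 hα)
  have hV : ∀ v, (D.δ₂ (D.ς (D.ofV v)) = (q : k) • D.ς (D.δ₂ (D.ofV v))) ↔
      (D.coord₂ v * (D.ν₂ * (D.lam₂ D.g₁)⁻¹)) • (D.ofS D.P₂ * D.w D.g₂)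
      = (D.coord₂ v * (q * (D.ν₂ * D.lam₂ D.g₂))) • (D.ofS D.P₂ * D.w D.g₂) := by
    intro v
    rw [ς_ofV, δ₂_ofV, δ₂_ofV, δhat₂_apply, δhat₂_apply, coord₂_ςhat, map_smul, e, smul_smul,
      smul_smul, mul_comm (D.coord₂ v), mul_comm (q : k) (D.coord₂ v), mul_assoc (D.coord₂ v), hinv]
  constructor
  · intro hc
    have h1 := smul_left_injective k (D.ofS_mul_w_ne_zero D.P₂_ne_zero D.g₂)
      ((hV D.x₂).1 (hc (D.ofV D.x₂)))
    rw [D.coord₂_spec.2, one_mul, one_mul] at h1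
    field_simp at h1 ⊢
    linear_combination h1
  · intro hq
    refine h.comp_eq_smul_comp D.ς_mul (fun x => ?_) (fun _ => rfl) q
      (fun v => ?_) (fun g => ?_)
    · simp only [AlgHom.toLinearMap_apply, ςαinv_apply, α_symm_ς]
    · have hq' : (q : k) = (D.lam₂ D.g₁ * D.lam₂ D.g₂)⁻¹ := by rw [← hq, inv_inv]
      rw [hV, hq']
      congr 1
      field_simp
    · simp only [ς_w, map_smul, δ₂_w, map_zero, smul_zero]

/-- The commutator is a `(ς, ς)`-skew derivation that kills the `w_g`, so it vanishes exactly when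
it vanishes on `V`. There `δ₂(x₁) = δ₁(x₂) = 0` leaves only `δ₂(P₁ w_{g₁})` and `δ₁(P₂ w_{g₂})`. -/
theorem δ₁_δ₂_comm_iff (h₁ : IsSkewDerivation D.α.toLinearMap D.ς D.δ₁)
    (h₂ : IsSkewDerivation D.ςαinv.toLinearMap LinearMap.id D.δ₂)
    (hα₁ : ∀ x, D.δ₁ (D.α x) = D.α (D.δ₁ x)) (hα₂ : ∀ x, D.δ₂ (D.α x) = D.α (D.δ₂ x)) (q : kˣ)
    (hς₁ : ∀ x, D.δ₁ (D.ς x) = (q : k) • D.ς (D.δ₁ x))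
    (hς₂ : ∀ x, D.δ₂ (D.ς x) = (q : k) • D.ς (D.δ₂ x)) :
    (∀ x, D.δ₁ (D.δ₂ x) = D.δ₂ (D.δ₁ x)) ↔
      D.δ₂ (D.ofS D.P₁) = 0 ∧ D.δ₁ (D.ofS D.P₂) = 0 := by
  -- The right twist of `δ₁` is `ς`, which contributes the unit `χς(g₂)`; that of `δ₂` is the
  -- identity, so `e₂` has no such factor.
  have e₁ : D.δ₁ (D.ofS D.P₂ * D.w D.g₂)
      = (D.χς D.g₂ : k) • (D.δ₁ (D.ofS D.P₂) * D.w D.g₂) := by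
    rw [h₁, δ₁_w, mul_zero, add_zero, ς_w, mul_smul_comm]
  have e₂ : D.δ₂ (D.ofS D.P₁ * D.w D.g₁) = D.δ₂ (D.ofS D.P₁) * D.w D.g₁ := by
    rw [h₂, δ₂_w, mul_zero, add_zero, LinearMap.id_apply]
  constructor
  · intro hc
    constructor
    · have h := hc (D.ofV D.x₁)
      rw [δ₂_x₁, map_zero, δ₁_x₁, e₂] at h
      exact CrossedProduct.eq_zero_of_mul_w h.symm
    · have h := hc (D.ofV D.x₂)
      rw [δ₁_x₂, map_zero, δ₂_x₂, e₁, smul_eq_zero, or_iff_right (Units.ne_zero _)] at h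
      exact CrossedProduct.eq_zero_of_mul_w h
  · rintro ⟨h5, h5'⟩
    have hα₁' : ∀ x, D.δ₁ (D.α.symm x) = D.α.symm (D.δ₁ x) := by
      intro x
      rw [AlgEquiv.eq_symm_apply, ← hα₁, AlgEquiv.apply_symm_apply]
    have hskew : IsSkewDerivation D.ς D.ς (D.δ₁ ∘ₗ D.δ₂ - D.δ₂ ∘ₗ D.δ₁) := by
      intro x y
      -- The mixed terms of the two expansions coincide. In `a1` the factor `q` comes from moving
      -- `δ₁` past `ςα⁻¹`, in `a2` from moving `δ₂` past `ς`. The outer terms use `α ∘ ςα⁻¹ = ς` and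
      -- `ςα⁻¹ ∘ α = ς`.
      have a1 : D.δ₁ (D.δ₂ (x * y)) = D.δ₁ (D.δ₂ x) * D.ς y + D.α (D.δ₂ x) * D.δ₁ y
          + ((q : k) • (D.ς (D.α.symm (D.δ₁ x)) * D.ς (D.δ₂ y)) + D.ς x * D.δ₁ (D.δ₂ y)) := by
        rw [h₂, map_add, h₁, h₁]
        simp only [LinearMap.id_apply, AlgEquiv.toLinearMap_apply, AlgHom.toLinearMap_apply,
          ςαinv_apply, hς₁, hα₁', α_ς, AlgEquiv.apply_symm_apply, smul_mul_assoc]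
      have a2 : D.δ₂ (D.δ₁ (x * y)) = D.δ₂ (D.δ₁ x) * D.ς y
          + (q : k) • (D.ς (D.α.symm (D.δ₁ x)) * D.ς (D.δ₂ y))
          + (D.α (D.δ₂ x) * D.δ₁ y + D.ς x * D.δ₂ (D.δ₁ y)) := by
        rw [h₁, map_add, h₂, h₂]
        simp only [LinearMap.id_apply, AlgEquiv.toLinearMap_apply, AlgHom.toLinearMap_apply,
          ςαinv_apply, hς₂, hα₂, AlgEquiv.symm_apply_apply, mul_smul_comm]
      simp only [LinearMap.sub_apply, LinearMap.comp_apply, a1, a2, sub_mul, mul_sub]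
      abel
    have hzero : IsSkewDerivation D.ς D.ς (0 : D.A →ₗ[k] D.A) := fun x y => by simp
    have := CrossedProduct.skewDerivation_ext hskew hzero (fun v => ?_) (fun g => ?_)
    · intro x
      exact sub_eq_zero.1 (LinearMap.congr_fun this x)
    · simp [δ₁_ofV, δ₂_ofV, δhat₁_apply, δhat₂_apply, e₁, e₂, h5, h5']
    · simp [δ₁_w, δ₂_w]

end FirstCase

/-! ### Module algebra structures over `H_q` in terms of operators on `A`. -/

namespace Braided

section Hq

variable {k A : Type*} [Field k] [Ring A] [Algebra k A] (q : kˣ) (α : A ≃ₐ[k] A)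

/-- Uniqueness of good transpositions gives access to the explicit formula on homogeneous elements.
-/
theorem goodTransposition_eq_transOf : goodTransposition q α = transOf q α :=
  (existsUnique_goodTransposition q α).unique (goodTransposition_spec q α)
    ⟨transOf_isTransposition q α, transOf_isGood q α, transOf_D₁ q α⟩

theorem comul_σ : Coalgebra.comul (R := k) (Hq.σ q) = Hq.σ q ⊗ₜ[k] Hq.σ q :=
  Hq.lift_σ ..

theorem comul_σinv : Coalgebra.comul (R := k) (Hq.σinv q) = Hq.σinv q ⊗ₜ[k] Hq.σinv q :=
  Hq.lift_σinv ..

theorem comul_D₁ : Coalgebra.comul (R := k) (Hq.D₁ q) =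
    Hq.D₁ q ⊗ₜ[k] Hq.σ q + 1 ⊗ₜ[k] Hq.D₁ q :=
  Hq.lift_D₁ ..

theorem comul_D₂ : Coalgebra.comul (R := k) (Hq.D₂ q) =
    Hq.D₂ q ⊗ₜ[k] 1 + Hq.σ q ⊗ₜ[k] Hq.D₂ q :=
  Hq.lift_D₂ ..

theorem comul_mul (x y : Hq q) : Coalgebra.comul (R := k) (x * y) =
    Coalgebra.comul (R := k) x * Coalgebra.comul (R := k) y :=
  map_mul (Hq.comulHom q) x y

/-- The operator `(act ⊗ act) ∘ (H ⊗ s ⊗ A)` on a pure tensor with homogeneous second factor. -/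
theorem map_act_middle (act : Hq q ⊗[k] A →ₗ[k] A) (u : Hq q) {n : ℤ} {v : Hq q}
    (hv : Homog q n v) (a b : A) :
    TensorProduct.map act act (middle (transOf q α) ((u ⊗ₜ v) ⊗ₜ (a ⊗ₜ b)))
      = act (u ⊗ₜ (α ^ n) a) ⊗ₜ act (v ⊗ₜ b) := by
  simp [middle, transOf_homog q α hv]

/-- As `D₁ ≠ 0` over a field, some linear functional on `H_q` does not vanish at `D₁`; applying it
to the second factor removes `D₁`. -/
theorem tmul_D₁_injective {a b : A} (h : a ⊗ₜ[k] Hq.D₁ q = b ⊗ₜ[k] Hq.D₁ q) : a = b := by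
  obtain ⟨φ, hφ⟩ : ∃ φ : Module.Dual k (Hq q), φ (Hq.D₁ q) ≠ 0 := by
    obtain ⟨ψ, hψ, -⟩ := Submodule.exists_le_ker_of_notMem (p := (⊥ : Submodule k (Hq q)))
      (v := Hq.D₁ q) (by simpa using D₁_ne_zero q)
    exact ⟨ψ, hψ⟩
  have h1 := congrArg (TensorProduct.rid k A ∘ LinearMap.lTensor A φ) h
  simp only [Function.comp_apply, LinearMap.lTensor_tmul, TensorProduct.rid_tmul] at h1
  exact smul_right_injective A hφ h1

variable {q α}

theorem IsModuleAlgebra.act_mul_σ {act : Hq q ⊗[k] A →ₗ[k] A}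
    (h : IsModuleAlgebra (goodTransposition q α) act) (a b : A) :
    act (Hq.σ q ⊗ₜ (a * b)) = act (Hq.σ q ⊗ₜ a) * act (Hq.σ q ⊗ₜ b) := by
  rw [h.act_mul, goodTransposition_eq_transOf, comul_σ, map_act_middle q α act _ Homog.sigma]
  simp

/-- In `Δ(D₁) = D₁ ⊗ σ + 1 ⊗ D₁` the second tensor factor passes `a`: `σ` has degree `0` and leaves
it unchanged, `D₁` has degree `1` and applies `α`. For `D₂`, of degree `-1`, the twist is `α⁻¹`. -/
theorem IsModuleAlgebra.act_mul_D₁ {act : Hq q ⊗[k] A →ₗ[k] A}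
    (h : IsModuleAlgebra (goodTransposition q α) act) (a b : A) :
    act (Hq.D₁ q ⊗ₜ (a * b)) =
      act (Hq.D₁ q ⊗ₜ a) * act (Hq.σ q ⊗ₜ b) + α a * act (Hq.D₁ q ⊗ₜ b) := by
  rw [h.act_mul, goodTransposition_eq_transOf, comul_D₁, TensorProduct.add_tmul, map_add, map_add,
    map_act_middle q α act _ Homog.sigma, map_act_middle q α act _ Homog.D1]
  simp [h.one_act]

theorem IsModuleAlgebra.act_mul_D₂ {act : Hq q ⊗[k] A →ₗ[k] A}
    (h : IsModuleAlgebra (goodTransposition q α) act) (a b : A) :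
    act (Hq.D₂ q ⊗ₜ (a * b)) =
      act (Hq.D₂ q ⊗ₜ a) * b + act (Hq.σ q ⊗ₜ α.symm a) * act (Hq.D₂ q ⊗ₜ b) := by
  rw [h.act_mul, goodTransposition_eq_transOf, comul_D₂, TensorProduct.add_tmul, map_add, map_add,
    map_act_middle q α act _ Homog.one, map_act_middle q α act _ Homog.D2]
  simp [h.one_act, AlgEquiv.aut_inv]

/-- This is the braid axiom with `D₁` as the element passing through: each side is a tensor with
`D₁`, which can be removed. -/
theorem IsModuleAlgebra.act_α {act : Hq q ⊗[k] A →ₗ[k] A}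
    (h : IsModuleAlgebra (goodTransposition q α) act) (x : Hq q) (a : A) :
    act (x ⊗ₜ α a) = α (act (x ⊗ₜ a)) := by
  have h1 := h.braid (Hq.D₁ q) x a
  rw [goodTransposition_eq_transOf, transOf_D₁, LinearMap.lTensor_tmul, transOf_D₁,
    TensorProduct.assoc_symm_tmul, LinearMap.rTensor_tmul] at h1
  exact (tmul_D₁_injective q h1).symm

/-- The linear map `H_q ⊗ A → A` of an algebra homomorphism `H_q → End A`. -/
noncomputable def actOf (Φ : Hq q →ₐ[k] Module.End k A) : Hq q ⊗[k] A →ₗ[k] A :=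
  TensorProduct.lift Φ.toLinearMap

theorem actOf_tmul (Φ : Hq q →ₐ[k] Module.End k A) (x : Hq q) (a : A) :
    actOf Φ (x ⊗ₜ a) = Φ x a := rfl

theorem apply_comm_zpow {T : Module.End k A} (hT : ∀ a, T (α a) = α (T a)) (n : ℤ) (a : A) :
    T ((α ^ n) a) = (α ^ n) (T a) := by
  induction n generalizing a with
  | zero => simp
  | succ n ih => rw [zpow_add_one, AlgEquiv.mul_apply, ih, hT]; rfl
  | pred n ih =>
    rw [zpow_sub_one, AlgEquiv.mul_apply, ih, AlgEquiv.mul_apply]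
    congr 1
    rw [AlgEquiv.aut_inv, AlgEquiv.eq_symm_apply, ← hT, AlgEquiv.apply_symm_apply]

variable {Φ : Hq q →ₐ[k] Module.End k A}

theorem homog_apply_comm (hσ : ∀ a, Φ (Hq.σ q) (α a) = α (Φ (Hq.σ q) a))
    (hσinv : ∀ a, Φ (Hq.σinv q) (α a) = α (Φ (Hq.σinv q) a))
    (h₁ : ∀ a, Φ (Hq.D₁ q) (α a) = α (Φ (Hq.D₁ q) a))
    (h₂ : ∀ a, Φ (Hq.D₂ q) (α a) = α (Φ (Hq.D₂ q) a)) (x : Hq q) (a : A) :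
    Φ x (α a) = α (Φ x a) := by
  refine homog_ind q (f := fun x => ∀ a, Φ x (α a) = α (Φ x a)) (by simp) ?_ ?_ ?_ x a
  · intro x y hx hy a
    simp [hx, hy]
  · intro c x hx a
    simp [hx]
  · intro n x hx
    induction hx with
    | one => simp
    | sigma => exact hσ
    | sigmaInv => exact hσinv
    | D1 => exact h₁
    | D2 => exact h₂
    | mul _ _ ihx ihy => intro a; rw [map_mul, Module.End.mul_apply, ihy, ihx]; rfl

/-- The operator of `t ∈ H_q ⊗ H_q` on `A ⊗ A`. -/
noncomputable def tensorAct (α : A ≃ₐ[k] A) (Φ : Hq q →ₐ[k] Module.End k A) (t : Hq q ⊗[k] Hq q) :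
    A ⊗[k] A →ₗ[k] A ⊗[k] A :=
  TensorProduct.map (actOf Φ) (actOf Φ) ∘ₗ middle (transOf q α) ∘ₗ TensorProduct.mk k _ _ t

theorem tensorAct_homog (u : Hq q) {n : ℤ} {v : Hq q} (hv : Homog q n v) (a b : A) :
    tensorAct α Φ (u ⊗ₜ v) (a ⊗ₜ b) = Φ u ((α ^ n) a) ⊗ₜ Φ v b :=
  map_act_middle q α (actOf Φ) u hv a b

theorem tensorAct_add (t t' : Hq q ⊗[k] Hq q) :
    tensorAct α Φ (t + t') = tensorAct α Φ t + tensorAct α Φ t' := by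
  simp [tensorAct, LinearMap.comp_add]

theorem tensorAct_smul (c : k) (t : Hq q ⊗[k] Hq q) :
    tensorAct α Φ (c • t) = c • tensorAct α Φ t := by
  simp [tensorAct, LinearMap.comp_smul]

theorem tensorAct_zero : tensorAct α Φ 0 = 0 := by
  simpa using tensorAct_smul (α := α) (Φ := Φ) 0 0

/-- For homogeneous second factors of degrees `m` and `n` both sides apply `α^(m+n)` to the first
argument. On the right `α^m` stands to the left of `Φ u'`, and `hα` allows them to be exchanged.
Together with multiplicativity of `Δ`, this carries the product axiom from generators of `H_q` to
products. -/
theorem tensorAct_mul (hα : ∀ x a, Φ x (α a) = α (Φ x a)) (t t' : Hq q ⊗[k] Hq q) :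
    tensorAct α Φ (t * t') = tensorAct α Φ t ∘ₗ tensorAct α Φ t' := by
  induction t using TensorProduct.induction_on with
  | zero => simp [tensorAct_zero]
  | add x y hx hy => rw [add_mul, tensorAct_add, hx, hy, tensorAct_add, LinearMap.add_comp]
  | tmul u v =>
    induction t' using TensorProduct.induction_on with
    | zero => simp [tensorAct_zero]
    | add x y hx hy => rw [mul_add, tensorAct_add, hx, hy, tensorAct_add, LinearMap.comp_add]
    | tmul u' v' =>
      rw [Algebra.TensorProduct.tmul_mul_tmul]
      refine homog_ind q (f := fun v => tensorAct α Φ ((u * u') ⊗ₜ (v * v')) =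
        tensorAct α Φ (u ⊗ₜ v) ∘ₗ tensorAct α Φ (u' ⊗ₜ v')) (by simp [tensorAct_zero]) ?_ ?_ ?_ v
      · intro x y hx hy
        rw [add_mul, TensorProduct.tmul_add, TensorProduct.tmul_add, tensorAct_add, tensorAct_add,
          hx, hy, LinearMap.add_comp]
      · intro c x hx
        rw [smul_mul_assoc, TensorProduct.tmul_smul, TensorProduct.tmul_smul, tensorAct_smul,
          tensorAct_smul, hx, LinearMap.smul_comp]
      intro m x hx
      refine homog_ind q (f := fun v' => tensorAct α Φ ((u * u') ⊗ₜ (x * v')) =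
        tensorAct α Φ (u ⊗ₜ x) ∘ₗ tensorAct α Φ (u' ⊗ₜ v')) (by simp [tensorAct_zero]) ?_ ?_ ?_ v'
      · intro y z hy hz
        rw [mul_add, TensorProduct.tmul_add, TensorProduct.tmul_add, tensorAct_add, tensorAct_add,
          hy, hz, LinearMap.comp_add]
      · intro c y hy
        rw [mul_smul_comm, TensorProduct.tmul_smul, TensorProduct.tmul_smul, tensorAct_smul,
          tensorAct_smul, hy, LinearMap.comp_smul]
      intro n y hy
      refine TensorProduct.ext' fun a b => ?_
      rw [LinearMap.comp_apply, tensorAct_homog _ (hx.mul hy), tensorAct_homog _ hy,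
        tensorAct_homog _ hx, map_mul, map_mul, zpow_add, Module.End.mul_apply,
        Module.End.mul_apply, AlgEquiv.mul_apply, apply_comm_zpow (hα u')]

/-- A criterion for an algebra homomorphism `H_q → End A` to define a module algebra structure. -/
theorem isModuleAlgebra_actOf (hα : ∀ x a, Φ x (α a) = α (Φ x a))
    (hσ : ∀ a b, Φ (Hq.σ q) (a * b) = Φ (Hq.σ q) a * Φ (Hq.σ q) b) (hσ1 : Φ (Hq.σ q) 1 = 1)
    (h₁ : ∀ a b, Φ (Hq.D₁ q) (a * b) = Φ (Hq.D₁ q) a * Φ (Hq.σ q) b + α a * Φ (Hq.D₁ q) b)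
    (h₂ : ∀ a b, Φ (Hq.D₂ q) (a * b) =
      Φ (Hq.D₂ q) a * b + Φ (Hq.σ q) (α.symm a) * Φ (Hq.D₂ q) b) :
    IsModuleAlgebra (goodTransposition q α) (actOf Φ) := by
  have hσi : ∀ a, Φ (Hq.σinv q) (Φ (Hq.σ q) a) = a := by
    intro a
    rw [← Module.End.mul_apply, ← map_mul, Hq.σinv_mul_σ, map_one]; rfl
  have hσi' : ∀ a, Φ (Hq.σ q) (Φ (Hq.σinv q) a) = a := by
    intro a
    rw [← Module.End.mul_apply, ← map_mul, Hq.σ_mul_σinv, map_one]; rfl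
  have hσinv : ∀ a b, Φ (Hq.σinv q) (a * b) = Φ (Hq.σinv q) a * Φ (Hq.σinv q) b := by
    intro a b
    conv_lhs => rw [← hσi' a, ← hσi' b, ← hσ, hσi]
  -- The Leibniz rule at `1 · 1` gives the value at `1` twice.
  have hD₁1 : Φ (Hq.D₁ q) 1 = 0 := by simpa [hσ1] using h₁ 1 1
  have hD₂1 : Φ (Hq.D₂ q) 1 = 0 := by simpa [hσ1] using h₂ 1 1
  rw [goodTransposition_eq_transOf]
  refine ⟨transOf_isTransposition q α, fun a => by simp [actOf_tmul], fun x y a => by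
    simp [actOf_tmul], fun x y a => ?_, fun x a b => ?_, fun x => ?_⟩
  · refine homog_ind q (f := fun x => transOf q α (x ⊗ₜ actOf Φ (y ⊗ₜ a)) =
      LinearMap.rTensor (Hq q) (actOf Φ) ((TensorProduct.assoc k (Hq q) A (Hq q)).symm
        (LinearMap.lTensor (Hq q) (transOf q α) (y ⊗ₜ (x ⊗ₜ a))))) (by simp) ?_ ?_ ?_ x
    · intro x x' hx hx'
      simp only [TensorProduct.add_tmul, TensorProduct.tmul_add, map_add, hx, hx']
    · intro c x hx
      simp only [← TensorProduct.smul_tmul', TensorProduct.tmul_smul, map_smul, hx]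
    · intro n x hx
      rw [transOf_homog q α hx, LinearMap.lTensor_tmul, transOf_homog q α hx,
        TensorProduct.assoc_symm_tmul, LinearMap.rTensor_tmul, actOf_tmul, actOf_tmul,
        apply_comm_zpow (hα y)]
  -- As an identity of operators on `A ⊗ A`, the product axiom is linear in `x` and stable under
  -- products of `x`, so induction over homogeneous elements reduces it to `1`, `σ`, `σ⁻¹`, `D₁`,
  -- `D₂`.
  · have key : Φ x ∘ₗ LinearMap.mul' k A =
        LinearMap.mul' k A ∘ₗ tensorAct α Φ (Coalgebra.comul (R := k) x) := by
      refine homog_ind q (f := fun x => Φ x ∘ₗ LinearMap.mul' k A =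
        LinearMap.mul' k A ∘ₗ tensorAct α Φ (Coalgebra.comul (R := k) x)) ?_ ?_ ?_ ?_ x
      · simp [tensorAct_zero]
      · intro x y hx hy
        rw [map_add, map_add, tensorAct_add, LinearMap.add_comp, LinearMap.comp_add, hx, hy]
      · intro c x hx
        rw [map_smul, map_smul, tensorAct_smul, LinearMap.smul_comp, LinearMap.comp_smul, hx]
      · intro n x hx
        induction hx with
        | one =>
          refine TensorProduct.ext' fun a b => ?_
          rw [show Coalgebra.comul (R := k) (1 : Hq q) = 1 ⊗ₜ 1 from map_one (Hq.comulHom q),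
            LinearMap.comp_apply, LinearMap.comp_apply, tensorAct_homog _ Homog.one]
          simp
        | sigma =>
          refine TensorProduct.ext' fun a b => ?_
          rw [comul_σ, LinearMap.comp_apply, LinearMap.comp_apply, tensorAct_homog _ Homog.sigma]
          simp [hσ]
        | sigmaInv =>
          refine TensorProduct.ext' fun a b => ?_
          rw [comul_σinv, LinearMap.comp_apply, LinearMap.comp_apply,
            tensorAct_homog _ Homog.sigmaInv]
          simp [hσinv]
        | D1 =>
          refine TensorProduct.ext' fun a b => ?_
          rw [comul_D₁, LinearMap.comp_apply, LinearMap.comp_apply, tensorAct_add,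
            LinearMap.add_apply, tensorAct_homog _ Homog.sigma, tensorAct_homog _ Homog.D1]
          simp [h₁]
        | D2 =>
          refine TensorProduct.ext' fun a b => ?_
          rw [comul_D₂, LinearMap.comp_apply, LinearMap.comp_apply, tensorAct_add,
            LinearMap.add_apply, tensorAct_homog _ Homog.one, tensorAct_homog _ Homog.D2]
          simp [h₂, AlgEquiv.aut_inv]
        | mul _ _ ihx ihy =>
          rw [comul_mul, tensorAct_mul hα, ← LinearMap.comp_assoc, ← ihx, LinearMap.comp_assoc,
            ← ihy, map_mul]
          rfl
    exact LinearMap.congr_fun key (a ⊗ₜ b)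
  · have hcounit : ∀ y : Hq q, Coalgebra.counit (R := k) y = Hq.counitHom q y := fun _ => rfl
    rw [hcounit, actOf_tmul]
    refine homog_ind q (f := fun x => Φ x 1 = Hq.counitHom q x • (1 : A)) (by simp) ?_ ?_ ?_ x
    · intro x y hx hy
      simp [hx, hy, add_smul]
    · intro c x hx
      simp [hx, mul_smul]
    · intro n x hx
      induction hx with
      | one => simp
      | sigma => simp [Hq.counitHom, hσ1]
      | sigmaInv =>
        have := hσi 1
        rw [hσ1] at this
        simp [Hq.counitHom, this]
      | D1 => simp [Hq.counitHom, hD₁1]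
      | D2 => simp [Hq.counitHom, hD₂1]
      | mul _ _ ihx ihy =>
        rw [map_mul, map_mul, Module.End.mul_apply, ihy, map_smul, ihx, smul_smul, mul_comm]

end Hq

end Braided

/-! ### Assembly: from the action to `ς`, `δ₁`, `δ₂`. -/

namespace FirstCase

variable {k G V : Type*} [Field k] [Group G] [AddCommGroup V] [Module k V]
  [FiniteDimensional k V] (D : FirstCase k G V)

/-- The algebra homomorphism `H_q → End A` with `σ ↦ ς`, `Dᵢ ↦ δᵢ`. -/
noncomputable def rep (q : kˣ) (hς₁ : ∀ x, D.δ₁ (D.ς x) = (q : k) • D.ς (D.δ₁ x))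
    (hς₂ : ∀ x, D.δ₂ (D.ς x) = (q : k) • D.ς (D.δ₂ x))
    (hc : ∀ x, D.δ₁ (D.δ₂ x) = D.δ₂ (D.δ₁ x))
    (hl : ∀ l : ℕ, 2 ≤ l → IsPrimitiveRoot (q : k) l → D.δ₁ ^ l = 0 ∧ D.δ₂ ^ l = 0) :
    Hq q →ₐ[k] Module.End k D.A :=
  Hq.lift q D.ς D.ςAut.symm.toLinearMap D.δ₁ D.δ₂ (LinearMap.ext hc)
    (LinearMap.ext D.ςAut.apply_symm_apply) (LinearMap.ext D.ςAut.symm_apply_apply)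
    (LinearMap.ext hς₁) (LinearMap.ext hς₂) (fun l h h' => (hl l h h').1)
    (fun l h h' => (hl l h h').2)

/-- In a module algebra `σ` acts multiplicatively and the `Dᵢ` satisfy the same left Leibniz rules
as the `δᵢ`, so agreement on `V` and the `w_g` spreads to all of `A`. The identity for `σ` is proved
beforehand because it occurs in the rules for `D₁` and `D₂`. -/
theorem act_generators_iff (q : kˣ) (act : Hq q ⊗[k] D.A →ₗ[k] D.A)
    (hact : Braided.IsModuleAlgebra (D.s q) act) :
    ((∀ v : V, act (Hq.σ q ⊗ₜ D.ofV v) = D.ofV (D.ςhat v)) ∧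
      (∀ g : G, act (Hq.σ q ⊗ₜ D.w g) = (D.χς g : k) • D.w g) ∧
      (∀ v : V, act (Hq.D₁ q ⊗ₜ D.ofV v) = D.δhat₁ v) ∧
      (∀ v : V, act (Hq.D₂ q ⊗ₜ D.ofV v) = D.δhat₂ v) ∧
      (∀ g : G, act (Hq.D₁ q ⊗ₜ D.w g) = 0) ∧
      (∀ g : G, act (Hq.D₂ q ⊗ₜ D.w g) = 0)) ↔
    (∀ x, act (Hq.σ q ⊗ₜ x) = D.ς x) ∧ (∀ x, act (Hq.D₁ q ⊗ₜ x) = D.δ₁ x) ∧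
      (∀ x, act (Hq.D₂ q ⊗ₜ x) = D.δ₂ x) := by
  constructor
  · rintro ⟨hσV, hσw, h1V, h2V, h1w, h2w⟩
    have hσ : ∀ x, act (Hq.σ q ⊗ₜ x) = D.ς x := by
      refine LinearMap.congr_fun (f := act ∘ₗ TensorProduct.mk k _ _ (Hq.σ q)) ?_
      refine CrossedProduct.linearMap_ext_left (fun g => ?_) fun v x hx => ?_
      · simpa [ς_w] using hσw g
      · simp only [LinearMap.comp_apply, TensorProduct.mk_apply] at hx ⊢
        rw [hact.act_mul_σ, hσV, hx, ς_mul, ς_ofV]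
    refine ⟨hσ, ?_, ?_⟩
    · refine LinearMap.congr_fun (f := act ∘ₗ TensorProduct.mk k _ _ (Hq.D₁ q)) ?_
      refine CrossedProduct.linearMap_ext_left (fun g => ?_) fun v x hx => ?_
      · simpa [δ₁_w] using h1w g
      · simp only [LinearMap.comp_apply, TensorProduct.mk_apply] at hx ⊢
        rw [hact.act_mul_D₁, h1V, hx, hσ, δ₁_ofV_mul, δ₁_ofV]
    · refine LinearMap.congr_fun (f := act ∘ₗ TensorProduct.mk k _ _ (Hq.D₂ q)) ?_
      refine CrossedProduct.linearMap_ext_left (fun g => ?_) fun v x hx => ?_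
      · simpa [δ₂_w] using h2w g
      · simp only [LinearMap.comp_apply, TensorProduct.mk_apply] at hx ⊢
        rw [hact.act_mul_D₂, h2V, hx, hσ, δ₂_ofV_mul, δ₂_ofV]
  · rintro ⟨hσ, h1, h2⟩
    simp only [hσ, h1, h2]
    exact ⟨D.ς_ofV, D.ς_w, D.δ₁_ofV, D.δ₂_ofV, D.δ₁_w, D.δ₂_w⟩

/-- A module algebra structure with the prescribed values on generators exists if and only if
`ς`, `δ₁`, `δ₂` satisfy the relations of `H_q`, commute with `α` and the `δᵢ` are skew
derivations. -/
theorem exists_act_iff (q : kˣ) :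
    (∃ act : Hq q ⊗[k] D.A →ₗ[k] D.A, Braided.IsModuleAlgebra (D.s q) act ∧
      (∀ x, act (Hq.σ q ⊗ₜ x) = D.ς x) ∧ (∀ x, act (Hq.D₁ q ⊗ₜ x) = D.δ₁ x) ∧
      (∀ x, act (Hq.D₂ q ⊗ₜ x) = D.δ₂ x)) ↔
    IsSkewDerivation D.α.toLinearMap D.ς D.δ₁ ∧
    IsSkewDerivation D.ςαinv.toLinearMap LinearMap.id D.δ₂ ∧
    (∀ x, D.δ₁ (D.α x) = D.α (D.δ₁ x)) ∧ (∀ x, D.δ₂ (D.α x) = D.α (D.δ₂ x)) ∧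
    (∀ x, D.δ₁ (D.ς x) = (q : k) • D.ς (D.δ₁ x)) ∧
    (∀ x, D.δ₂ (D.ς x) = (q : k) • D.ς (D.δ₂ x)) ∧
    (∀ x, D.δ₁ (D.δ₂ x) = D.δ₂ (D.δ₁ x)) ∧
    (∀ l : ℕ, 2 ≤ l → IsPrimitiveRoot (q : k) l → D.δ₁ ^ l = 0 ∧ D.δ₂ ^ l = 0) := by
  constructor
  · rintro ⟨act, hact, hσ, h1, h2⟩
    refine ⟨fun x y => ?_, fun x y => ?_, fun x => ?_, fun x => ?_, fun x => ?_, fun x => ?_,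
      fun x => ?_, fun l hl hq => ?_⟩
    · have h := hact.act_mul_D₁ x y
      simp only [hσ, h1] at h
      exact h
    · have h := hact.act_mul_D₂ x y
      simp only [hσ, h2] at h
      exact h
    · simpa only [h1] using hact.act_α (Hq.D₁ q) x
    · simpa only [h2] using hact.act_α (Hq.D₂ q) x
    · have h := hact.mul_act (Hq.D₁ q) (Hq.σ q) x
      rw [Hq.D₁_mul_σ, ← TensorProduct.smul_tmul', map_smul, hact.mul_act] at h
      simpa only [hσ, h1] using h.symm
    · have h := hact.mul_act (Hq.D₂ q) (Hq.σ q) x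
      rw [Hq.D₂_mul_σ, ← TensorProduct.smul_tmul', map_smul, hact.mul_act] at h
      simpa only [hσ, h2] using h.symm
    · have h := hact.mul_act (Hq.D₁ q) (Hq.D₂ q) x
      rw [Hq.D₁_mul_D₂, hact.mul_act] at h
      simpa only [h1, h2] using h.symm
    -- Powers in `H_q` act as powers of operators, so `Dᵢˡ = 0` forces `δᵢˡ = 0`.
    · have hpow : ∀ (y : Hq q) (δ : Module.End k D.A), (∀ x, act (y ⊗ₜ x) = δ x) →
          ∀ n x, act ((y ^ n) ⊗ₜ x) = (δ ^ n) x := by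
        intro y δ hy n
        induction n with
        | zero => simpa using hact.one_act
        | succ n ih => intro x; rw [pow_succ, hact.mul_act, hy, ih, pow_succ]; rfl
      constructor
      · ext1 x
        rw [← hpow _ _ h1, Hq.D₁_pow q l hl hq]
        simp
      · ext1 x
        rw [← hpow _ _ h2, Hq.D₂_pow q l hl hq]
        simp
  · rintro ⟨hd₁, hd₂, hα₁, hα₂, hς₁, hς₂, hc, hl⟩
    have eσ : D.rep q hς₁ hς₂ hc hl (Hq.σ q) = D.ς := Hq.lift_σ ..
    have eσi : D.rep q hς₁ hς₂ hc hl (Hq.σinv q) = D.ςAut.symm.toLinearMap := Hq.lift_σinv ..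
    have e₁ : D.rep q hς₁ hς₂ hc hl (Hq.D₁ q) = D.δ₁ := Hq.lift_D₁ ..
    have e₂ : D.rep q hς₁ hς₂ hc hl (Hq.D₂ q) = D.δ₂ := Hq.lift_D₂ ..
    refine ⟨Braided.actOf (D.rep q hς₁ hς₂ hc hl), ?_, ?_, ?_, ?_⟩
    · refine Braided.isModuleAlgebra_actOf (Braided.homog_apply_comm ?_ ?_ ?_ ?_) ?_ ?_ ?_ ?_
      · rw [eσ]; exact fun a => (D.α_ς a).symm
      · rw [eσi]
        intro a
        simp only [AlgEquiv.toLinearMap_apply]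
        rw [AlgEquiv.symm_apply_eq, ςAut_apply, ← α_ς, ← ςAut_apply, AlgEquiv.apply_symm_apply]
      · rw [e₁]; exact hα₁
      · rw [e₂]; exact hα₂
      · rw [eσ]; exact D.ς_mul
      · rw [eσ]; exact D.ς_one
      · rw [eσ, e₁]; exact hd₁
      · rw [eσ, e₂]; exact hd₂
    · intro x; rw [Braided.actOf_tmul, eσ]
    · intro x; rw [Braided.actOf_tmul, e₁]
    · intro x; rw [Braided.actOf_tmul, e₂]

end FirstCase

theorem mainTheorem6 {k G V : Type*} [Field k] [Group G] [AddCommGroup V] [Module k V]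
    [FiniteDimensional k V] (q : kˣ) (D : FirstCase k G V) :
    (∃ act : Hq q ⊗[k] D.A →ₗ[k] D.A,
      Braided.IsModuleAlgebra (D.s q) act ∧
      (∀ v : V, act (Hq.σ q ⊗ₜ D.ofV v) = D.ofV (D.ςhat v)) ∧
      (∀ g : G, act (Hq.σ q ⊗ₜ D.w g) = (D.χς g : k) • D.w g) ∧
      (∀ v : V, act (Hq.D₁ q ⊗ₜ D.ofV v) = D.δhat₁ v) ∧
      (∀ v : V, act (Hq.D₂ q ⊗ₜ D.ofV v) = D.δhat₂ v) ∧
      (∀ g : G, act (Hq.D₁ q ⊗ₜ D.w g) = 0) ∧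
      (∀ g : G, act (Hq.D₂ q ⊗ₜ D.w g) = 0)) ↔
    ((q : k) = D.lam₁ D.g₁ * D.lam₁ D.g₂ ∧ (q : k)⁻¹ = D.lam₂ D.g₁ * D.lam₂ D.g₂) ∧
    (∀ g : G, symMap (D.ρ g) D.P₁ =
      (D.lam₁ g * (D.χα g : k)⁻¹ * (D.χς g : k) * (D.f g D.g₁ : k)⁻¹ * (D.f D.g₁ g : k)) • D.P₁) ∧
    (∀ g : G, symMap (D.ρ g) D.P₂ =
      (D.lam₂ g * (D.χα g : k) * (D.χς g : k)⁻¹ * (D.f g D.g₂ : k)⁻¹ * (D.f D.g₂ g : k)) • D.P₂) ∧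
    (D.α (D.ofS D.P₁) = (D.ν₁ * (D.χα D.g₁ : k)⁻¹) • D.ofS D.P₁ ∧
      D.α (D.ofS D.P₂) = (D.ν₂ * (D.χα D.g₂ : k)⁻¹) • D.ofS D.P₂) ∧
    (D.δ₂ (D.ofS D.P₁) = 0 ∧ D.δ₁ (D.ofS D.P₂) = 0) ∧
    (∀ l : ℕ, 2 ≤ l → IsPrimitiveRoot (q : k) l → D.δ₁ ^ l = 0 ∧ D.δ₂ ^ l = 0) := by
  have h0 := fun act hact => D.act_generators_iff q act hact
  -- After this step the action has disappeared, and the left side is a list of properties of `ς`,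
  -- `δ₁`, `δ₂`.
  rw [exists_congr fun act => and_congr_right (h0 act), D.exists_act_iff q]
  constructor
  · rintro ⟨hd₁, hd₂, hα₁, hα₂, hς₁, hς₂, hc, hl⟩
    exact ⟨⟨(D.δ₁_ς_iff hd₁ hα₁ q).1 hς₁, (D.δ₂_ς_iff hd₂ hα₂ q).1 hς₂⟩,
      D.isSkewDerivation_δ₁_iff.1 hd₁, D.isSkewDerivation_δ₂_iff.1 hd₂,
      ⟨(D.δ₁_α_iff hd₁).1 hα₁, (D.δ₂_α_iff hd₂).1 hα₂⟩,
      (D.δ₁_δ₂_comm_iff hd₁ hd₂ hα₁ hα₂ q hς₁ hς₂).1 hc, hl⟩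
  -- The order is dictated by dependence: commutation with `α` presupposes the Leibniz rules, the
  -- relation with `ς` presupposes both, and the commutator uses all of them.
  · rintro ⟨⟨hq₁, hq₂⟩, h₁, h₂, ⟨h₃, h₄⟩, h₅, hl⟩
    have hd₁ := D.isSkewDerivation_δ₁_iff.2 h₁
    have hd₂ := D.isSkewDerivation_δ₂_iff.2 h₂
    have hα₁ := (D.δ₁_α_iff hd₁).2 h₃
    have hα₂ := (D.δ₂_α_iff hd₂).2 h₄
    have hς₁ := (D.δ₁_ς_iff hd₁ hα₁ q).2 hq₁
    have hς₂ := (D.δ₂_ς_iff hd₂ hα₂ q).2 hq₂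
    exact ⟨hd₁, hd₂, hα₁, hα₂, hς₁, hς₂,
      (D.δ₁_δ₂_comm_iff hd₁ hd₂ hα₁ hα₂ q hς₁ hς₂).2 h₅, hl⟩
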